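/- All sets and families below are finite; a family is a finite set of finite subsets of $\mathbb{N}$. A family $F$ is union-closed if $A\cup B\in F$ for all $A,B\in F$. The closure of a family $F$ is the least union-closed family that contains $F$. A family $F_c$ is an FC-family if for every union-closed family $F\supseteq F_c$ there is an element $a\in\bigcup F_c$ that belongs to at least half of the members of $F$, i.e. $2\cdot|\{A\in F : a\in A\}|\ge |F|$. A family that is not an FC-family is a nonFC-family. Let $\mathcal{F}_c^6$ and $\mathcal{N}_c^6$ be the two collections of families of subsets of $\{0,1,2,3,4,5\}$ that are listed below. In the lists a string of digits stands for the set of its digits (so $0124$ is $\{0,1,2,4\}$), the members of a family are separated by blanks, and the families are separated by semicolons. Theorem. $\mathcal{F}_c^6$ consists of 197 distinct families, and every one of them is an FC-family. $\mathcal{N}_c^6$ consists of 115 distinct families, and every one of them is a nonFC-family; moreover the closure of every family in $\mathcal{N}_c^6$ is a nonFC-family. The collection $\mathcal{F}_c^6$: 0123 0124 0134 0234 01235 12345; 0123 0124 0125 0134 01345 02345 12345; 0123 0124 0134 0234 1234; 0123 0124 0134 0234 1235; 0123 0124 0125 0134 0235 12345; 0123 0124 0125 0134 0345 12345; 0123 0124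 0125 0345 1345 02345; 0123 0124 0134 0235 0245 12345; 0123 0124 0134 0235 1235 01245; 0123 0124 0134 0235 1245 02345; 0123 0124 0134 0235 2345 01245; 0123 0124 0134 0235 2345 12345; 0123 0124 0135 0145 2345 02345; 0123 0124 0135 0245 0345 12345; 0123 0124 0135 0245 1345 02345; 0123 0124 0125 0134 2345 01345 02345; 0123 0124 0125 0134 2345 02345 12345; 0123 0124 0125 0134 0135 0234; 0123 0124 0125 0134 0135 2345; 0123 0124 0125 0134 0234 0345; 0123 0124 0125 0134 0235 1245; 0123 0124 0125 0134 0135 0145 02345; 0123 0124 0125 0134 0135 0245 02345; 012 0134 0135 02345 12345; 012 0134 0234 01235 12345; 012 0134 0235 01245 12345; 012 0134 0235 01345 12345; 012 0134 0345 01235 01245 12345; 012 0134 2345 01235 01245 02345 12345; 012 0123 0134 01235 01245 01345 02345 12345; 012 0345 1345 01234 01235 01245 02345 12345; 012 0134 0234 1234; 012 0134 0234 1235; 012 0134 0235 1245; 012 0134 0235 1345; 012 0123 0134 0234 12345; 012 0123 0134 0235 12345; 012 0123 0134 0245 12345; 012 0123 0145 0245 12345; 012 0134 0135 0145 02345; 012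 0134 0135 0234 01245; 012 0134 0135 0245 02345; 012 0134 0135 0345 12345; 012 0134 0135 2345 01245; 012 0134 0135 2345 02345; 012 0134 0234 0345 12345; 012 0134 0234 1345 01235; 012 0134 0234 1345 12345; 012 0123 0134 0345 01245 12345; 012 0134 0345 1345 01235 01245; 012 0134 0345 1345 01235 02345; 012 0134 0345 2345 01235 01245; 012 0134 0345 2345 01235 12345; 012 0123 0134 0345 01235 02345 12345; 012 0123 0134 2345 01245 02345 12345; 012 0123 0145 0345 01234 02345 12345; 012 0123 0124 0134 01235 01245 02345 12345; 012 0123 0124 0134 01235 01345 02345 12345; 012 0123 0134 2345 01235 01345 02345 12345; 012 0123 0145 2345 01234 01345 02345 12345; 012 0123 0134 0135 0234; 012 0123 0134 0145 0234; 012 0123 0134 0234 1345; 012 0123 0145 0245 1345; 012 0134 0135 0145 0345; 012 0134 0135 0234 0235; 012 0134 0135 0234 0345; 012 0134 0135 0345 1345; 012 0134 0234 0345 1345; 012 0123 0124 0134 0345 12345; 012 0123 0134 0145 0245 02345; 012 0123 0134 0234 0345 01245; 012 0123 0134 0345 1345 01235; 012 0123 0134 0345 1345 01245; 012 0123 0134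 0345 1345 02345; 012 0123 0134 0345 2345 01235; 012 0123 0134 0345 2345 01245; 012 0123 0134 0345 2345 12345; 012 0123 0145 0345 1345 01234; 012 0123 0145 0345 1345 02345; 012 0123 0145 0345 2345 01234; 012 0123 0145 0345 2345 12345; 012 0123 0124 0134 2345 02345 12345; 012 0123 0124 0135 2345 02345 12345; 012 0123 0134 0135 0345 01245 02345; 012 0123 0134 0145 0345 01235 02345; 012 0123 0345 1345 2345 01234 01245; 012 0123 0124 0135 2345 01245 01345 02345; 012 0123 0124 0345 1345 01235 02345 12345; 012 0123 0124 0134 2345 01235 01245 01345 02345; 012 0123 0124 0134 0135 0245; 012 0123 0124 0134 0135 2345; 012 0123 0124 0134 0234 0345; 012 0123 0124 0134 0235 0245; 012 0123 0124 0134 0345 1345; 012 0123 0124 0134 0345 2345; 012 0123 0124 0135 0245 0345; 012 0123 0124 0345 1345 2345; 012 0123 0124 0125 0134 2345 02345; 012 0123 0124 0134 0135 0345 02345; 012 0123 0124 0134 0235 0345 01245; 012 0123 0124 0125 0134 0135 0345; 012 013 02345 12345; 012 034 01235 01245 01345 12345; 012 345 01234 01235 01245 01345 02345 12345; 012 013 0234;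 012 034 1234; 012 013 0145 02345; 012 013 0245 12345; 012 013 2345 02345; 012 034 0135 01245; 012 034 0135 12345; 012 034 1235 01345; 012 013 0245 01345 02345; 012 034 0123 01245 12345; 012 034 0123 01345 12345; 012 034 1235 01245 12345; 012 013 0245 01234 01235 01345; 012 013 0245 01234 01235 02345; 012 013 2345 01234 01245 01345; 012 034 0125 01235 01345 12345; 012 034 0125 01345 02345 12345; 012 345 0134 01235 01245 02345; 012 013 0145 0245; 012 013 0145 2345; 012 013 0245 1245; 012 013 0245 1345; 012 034 0123 0145; 012 034 0123 1345; 012 345 0134 0235; 012 013 0124 0245 01345; 012 013 0124 0245 02345; 012 013 0124 0345 01235; 012 013 0124 0345 01245; 012 013 0124 0345 02345; 012 013 0124 2345 01345; 012 034 0123 0124 12345; 012 034 0123 0134 12345; 012 034 0123 1235 01245; 012 034 0123 1245 01235; 012 034 0125 1235 01245; 012 034 0125 1235 12345; 012 034 0125 1345 02345; 012 034 0125 1345 12345; 012 345 0134 0135 01245; 012 345 0134 0135 02345; 012 013 0124 2345 01235 01245; 012 345 0123 0134 01245 02345; 012 345 0123 0134 02345 12345; 012 345 0123 0145 02345 12345;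 012 034 0123 0134 01235 01245 01345 02345; 012 345 0123 0124 01235 01345 02345 12345; 012 345 0123 0345 01234 01235 01245 01345 12345; 012 013 0124 0125 0245; 012 013 0124 0134 0245; 012 013 0124 0134 2345; 012 013 0124 0135 2345; 012 034 0123 0124 1235; 012 034 0123 0125 0135; 012 034 0123 0125 1235; 012 034 0123 0134 0135; 012 034 0123 0135 0345; 012 034 0123 0345 1235; 012 034 0123 0345 1245; 012 034 0125 0345 1235; 012 345 0123 0134 0145; 012 345 0123 0134 0234; 012 345 0123 0145 0245; 012 034 0123 0124 0134 02345; 012 034 0123 0125 0345 12345; 012 345 0123 0124 0135 02345; 012 345 0123 0134 0345 01245; 012 345 0123 0134 2345 01245; 012 034 0123 0125 0134 01245 02345; 012 345 0123 0134 2345 01235 02345; 012 345 0123 0145 2345 01234 02345; 012 034 0123 0124 0134 0234; 012 345 0123 0124 0134 2345; 012 345 0123 0124 0135 0345; 012 345 0123 0124 0135 2345; 012 034 0123 0124 0125 0345 01345 02345; 012 345 0123 0124 0345 1345 01235 01245; 012 345 0123 0124 0345 1345 01235 02345; 012 013 014; 012 013 023; 012 013 024; 012 013 045; 012 013 234; 012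 034 135; 012 013 245 02345; 012 013 245 01234 01345; 012 013 245 0245; 012 013 245 0124 01235; 012 013 245 2345 01234; 012 013 245 2345 01345; 01; 0. The collection $\mathcal{N}_c^6$: 0123 0124 0134 0234 12345; 0123 0124 0125 0134 02345 12345; 0123 0124 0135 0145 02345 12345; 0123 0124 0135 0245 01345 02345 12345; 0123 0124 0134 0235 01245 01345 02345 12345; 0123 0124 0135 2345 01245 01345 02345 12345; 0123 0124 0345 1345 01235 01245 02345 12345; 0123 0124 0134 2345 01235 01245 01345 02345 12345; 0123 0124 0134 0235 1235; 0123 0124 0134 0235 2345; 0123 0124 0135 0145 2345; 0123 0124 0135 0245 1345; 0123 0124 0125 0134 2345 02345; 0123 0124 0134 0235 1245 01345; 0123 0124 0125 0134 0135 0245; 0123 0124 0125 0134 0235 0345; 0123 0124 0134 0235 0245 0345; 012 0134 0235 12345; 012 0134 0234 01345 02345 12345; 012 0134 0345 01235 02345 12345; 012 0123 0134 01245 01345 02345 12345; 012 0134 2345 01235 01345 02345 12345; 012 0123 0145 01234 01235 01345 02345 12345; 012 0134 0135 0234 02345; 012 0134 0234 1345 02345; 012 0134 0345 2345 01235; 012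 0123 0134 0345 02345 12345; 012 0123 0145 0345 02345 12345; 012 0134 0135 0345 01245 02345; 012 0123 0124 0134 01235 02345 12345; 012 0123 0124 0134 01345 02345 12345; 012 0123 0124 0135 01245 02345 12345; 012 0123 0124 0135 01345 02345 12345; 012 0123 0134 2345 01235 02345 12345; 012 0123 0134 2345 01345 02345 12345; 012 0123 0145 2345 01234 02345 12345; 012 0123 0145 2345 01345 02345 12345; 012 0123 0134 2345 01235 01245 01345 02345; 012 0123 0145 2345 01234 01235 01345 02345; 012 0123 0345 1345 01234 01245 02345 12345; 012 0123 0134 0135 0245; 012 0123 0134 0135 2345; 012 0123 0134 0145 0235; 012 0123 0134 0145 0245; 012 0123 0134 0145 2345; 012 0123 0134 0345 2345; 012 0123 0145 0345 1345; 012 0123 0145 0345 2345; 012 0123 0124 0135 0345 12345; 012 0123 0134 0135 0345 02345; 012 0123 0134 0145 0345 02345; 012 0123 0134 0235 0345 01245; 012 0123 0134 0245 0345 01235; 012 0123 0124 0135 2345 01245 02345; 012 0123 0124 0135 2345 01345 02345; 012 0123 0124 0345 1345 02345 12345; 012 0123 0145 0245 0345 01234 01235; 012 0123 0124 0125 0345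 01345 02345 12345; 012 0123 0124 0134 2345 01235 01245 02345; 012 0123 0124 0134 2345 01235 01345 02345; 012 0123 0124 0345 1345 01235 01245 02345; 012 0123 0124 0125 0345 1345; 012 0123 0124 0134 0235 0345; 012 0123 0124 0135 0145 0345; 012 0123 0124 0125 0134 0345 02345; 012 0123 0124 0125 0134 2345 01345; 012 0123 0124 0134 0135 0345 01245; 012 0123 0124 0125 0134 0234 01345 02345; 012 0123 0124 0125 0134 0235 01345 02345; 012 034 01235 01345 12345; 012 034 1235 01245; 012 013 0245 01234 01345; 012 013 0245 01234 02345; 012 013 2345 01245 01345; 012 013 2345 01234 01235 01245; 012 034 0125 01235 01245 12345; 012 345 0123 01234 01245 01345 02345 12345; 012 013 0124 0345; 012 034 0123 0135; 012 034 0123 1245; 012 034 0125 1345; 012 013 0124 0245 01235; 012 013 0124 2345 01235; 012 013 0124 2345 01245; 012 034 0123 0125 12345; 012 034 0123 1235 12345; 012 034 0123 0345 01235 12345; 012 034 0125 0345 01235 12345; 012 345 0123 0145 01234 02345; 012 034 0123 0134 01235 01245 02345; 012 034 0125 0135 0345; 012 345 0123 0134 0135; 012 345 0123 0124 0134 02345;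 012 345 0123 0134 2345 01235; 012 345 0123 0134 2345 02345; 012 345 0123 0145 2345 01234; 012 034 0123 0124 0125 01345 02345; 012 345 0123 0134 0345 01235 02345; 012 034 0123 0125 0345 01245 01345 02345; 012 345 0123 0124 0345 01235 01345 12345; 012 345 0123 0124 0345 01345 02345 12345; 012 034 0123 0124 0345 01235 01245 01345 02345; 012 345 0123 0124 0125 0134; 012 345 0123 0124 0134 0345; 012 013 0124 0125 0134 0135 02345; 012 345 0123 0124 0125 0345 12345; 012 345 0123 0124 0345 1345 01235; 012 345 0123 0124 0125 0345 01345 02345; 012 013 0124 0125 0134 0135 0145; 012 034 0123 0124 0125 0134 0345; 012 013 245 01345; 012 013 245 01234 01235; 012 013 245 0124; 012 013 245 0134; 012 013 245 2345. -/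

import Mathlib

/-- A finite family of finite sets of natural numbers is union-closed if `A ∪ B` belongs to it
whenever `A` and `B` do (the supremum of two finsets is their union). -/
def UnionClosed (F : Finset (Finset ℕ)) : Prop :=
  SupClosed (F : Set (Finset ℕ))

/-- The number of members of `F` that contain `a`. -/
def occurrences (a : ℕ) (F : Finset (Finset ℕ)) : ℕ :=
  (F.filter fun A => a ∈ A).card

/-- Frankl's condition: `a` is an element of `⋃ F` that occurs in at least half of the members
of `F`. -/
def FranklCondition (a : ℕ) (F : Finset (Finset ℕ)) : Prop :=
  a ∈ F.biUnion id ∧ F.card ≤ 2 * occurrences a F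

/-- `Fc` is an FC-family: in every union-closed family `F ⊇ Fc`, one of the elements of `⋃ Fc`
satisfies Frankl's condition for `F`. -/
def IsFC (Fc : Finset (Finset ℕ)) : Prop :=
  ∀ F : Finset (Finset ℕ), UnionClosed F → Fc ⊆ F →
    ∃ a ∈ Fc.biUnion id, FranklCondition a F

/-- A nonFC-family is a family that is not an FC-family. -/
def IsNonFC (Fc : Finset (Finset ℕ)) : Prop :=
  ¬ IsFC Fc

/-- The closure of `F`: the least union-closed family that contains `F`. -/
noncomputable def unionClosure (F : Finset (Finset ℕ)) : Finset (Finset ℕ) :=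
  F.finite_toSet.supClosure.toFinset

/-- The subset of `{0, …, 5}` coded by the binary digits of `m`: the element `i` belongs to it iff
the digit of `2 ^ i` is `1`. For example `15` codes `{0, 1, 2, 3}` and `62` codes
`{1, 2, 3, 4, 5}`. -/
def setOfCode (m : ℕ) : Finset ℕ :=
  (Finset.range 6).filter fun i => m.testBit i = true

/-- The family of the sets coded by the members of a list. -/
def familyOfCodes (l : List ℕ) : Finset (Finset ℕ) :=
  (l.map setOfCode).toFinset

/-- The characteristic FC-families over `{0, …, 5}` (the minimal FC-families, one from each
isomorphism class), one family per line. -/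
def fcSixTable : List (List ℕ) := [
  [15,23,27,29,47,62],
  [15,23,39,27,59,61,62],
  [15,23,27,29,30],
  [15,23,27,29,46],
  [15,23,39,27,45,62],
  [15,23,39,27,57,62],
  [15,23,39,57,58,61],
  [15,23,27,45,53,62],
  [15,23,27,45,46,55],
  [15,23,27,45,54,61],
  [15,23,27,45,60,55],
  [15,23,27,45,60,62],
  [15,23,43,51,60,61],
  [15,23,43,53,57,62],
  [15,23,43,53,58,61],
  [15,23,39,27,60,59,61],
  [15,23,39,27,60,61,62],
  [15,23,39,27,43,29],
  [15,23,39,27,43,60],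
  [15,23,39,27,29,57],
  [15,23,39,27,45,54],
  [15,23,39,27,43,51,61],
  [15,23,39,27,43,53,61],
  [7,27,43,61,62],
  [7,27,29,47,62],
  [7,27,45,55,62],
  [7,27,45,59,62],
  [7,27,57,47,55,62],
  [7,27,60,47,55,61,62],
  [7,15,27,47,55,59,61,62],
  [7,57,58,31,47,55,61,62],
  [7,27,29,30],
  [7,27,29,46],
  [7,27,45,54],
  [7,27,45,58],
  [7,15,27,29,62],
  [7,15,27,45,62],
  [7,15,27,53,62],
  [7,15,51,53,62],
  [7,27,43,51,61],
  [7,27,43,29,55],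
  [7,27,43,53,61],
  [7,27,43,57,62],
  [7,27,43,60,55],
  [7,27,43,60,61],
  [7,27,29,57,62],
  [7,27,29,58,47],
  [7,27,29,58,62],
  [7,15,27,57,55,62],
  [7,27,57,58,47,55],
  [7,27,57,58,47,61],
  [7,27,57,60,47,55],
  [7,27,57,60,47,62],
  [7,15,27,57,47,61,62],
  [7,15,27,60,55,61,62],
  [7,15,51,57,31,61,62],
  [7,15,23,27,47,55,61,62],
  [7,15,23,27,47,59,61,62],
  [7,15,27,60,47,59,61,62],
  [7,15,51,60,31,59,61,62],
  [7,15,27,43,29],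
  [7,15,27,51,29],
  [7,15,27,29,58],
  [7,15,51,53,58],
  [7,27,43,51,57],
  [7,27,43,29,45],
  [7,27,43,29,57],
  [7,27,43,57,58],
  [7,27,29,57,58],
  [7,15,23,27,57,62],
  [7,15,27,51,53,61],
  [7,15,27,29,57,55],
  [7,15,27,57,58,47],
  [7,15,27,57,58,55],
  [7,15,27,57,58,61],
  [7,15,27,57,60,47],
  [7,15,27,57,60,55],
  [7,15,27,57,60,62],
  [7,15,51,57,58,31],
  [7,15,51,57,58,61],
  [7,15,51,57,60,31],
  [7,15,51,57,60,62],
  [7,15,23,27,60,61,62],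
  [7,15,23,43,60,61,62],
  [7,15,27,43,57,55,61],
  [7,15,27,51,57,47,61],
  [7,15,57,58,60,31,55],
  [7,15,23,43,60,55,59,61],
  [7,15,23,57,58,47,61,62],
  [7,15,23,27,60,47,55,59,61],
  [7,15,23,27,43,53],
  [7,15,23,27,43,60],
  [7,15,23,27,29,57],
  [7,15,23,27,45,53],
  [7,15,23,27,57,58],
  [7,15,23,27,57,60],
  [7,15,23,43,53,57],
  [7,15,23,57,58,60],
  [7,15,23,39,27,60,61],
  [7,15,23,27,43,57,61],
  [7,15,23,27,45,57,55],
  [7,15,23,39,27,43,57],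
  [7,11,61,62],
  [7,25,47,55,59,62],
  [7,56,31,47,55,59,61,62],
  [7,11,29],
  [7,25,30],
  [7,11,51,61],
  [7,11,53,62],
  [7,11,60,61],
  [7,25,43,55],
  [7,25,43,62],
  [7,25,46,59],
  [7,11,53,59,61],
  [7,25,15,55,62],
  [7,25,15,59,62],
  [7,25,46,55,62],
  [7,11,53,31,47,59],
  [7,11,53,31,47,61],
  [7,11,60,31,55,59],
  [7,25,39,47,59,62],
  [7,25,39,59,61,62],
  [7,56,27,47,55,61],
  [7,11,51,53],
  [7,11,51,60],
  [7,11,53,54],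
  [7,11,53,58],
  [7,25,15,51],
  [7,25,15,58],
  [7,56,27,45],
  [7,11,23,53,59],
  [7,11,23,53,61],
  [7,11,23,57,47],
  [7,11,23,57,55],
  [7,11,23,57,61],
  [7,11,23,60,59],
  [7,25,15,23,62],
  [7,25,15,27,62],
  [7,25,15,46,55],
  [7,25,15,54,47],
  [7,25,39,46,55],
  [7,25,39,46,62],
  [7,25,39,58,61],
  [7,25,39,58,62],
  [7,56,27,43,55],
  [7,56,27,43,61],
  [7,11,23,60,47,55],
  [7,56,15,27,55,61],
  [7,56,15,27,61,62],
  [7,56,15,51,61,62],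
  [7,25,15,27,47,55,59,61],
  [7,56,15,23,47,59,61,62],
  [7,56,15,57,31,47,55,59,62],
  [7,11,23,39,53],
  [7,11,23,27,53],
  [7,11,23,27,60],
  [7,11,23,43,60],
  [7,25,15,23,46],
  [7,25,15,39,43],
  [7,25,15,39,46],
  [7,25,15,27,43],
  [7,25,15,43,57],
  [7,25,15,57,46],
  [7,25,15,57,54],
  [7,25,39,57,46],
  [7,56,15,27,51],
  [7,56,15,27,29],
  [7,56,15,51,53],
  [7,25,15,23,27,61],
  [7,25,15,39,57,62],
  [7,56,15,23,43,61],
  [7,56,15,27,57,55],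
  [7,56,15,27,60,55],
  [7,25,15,39,27,55,61],
  [7,56,15,27,60,47,61],
  [7,56,15,51,60,31,61],
  [7,25,15,23,27,29],
  [7,56,15,23,27,60],
  [7,56,15,23,43,57],
  [7,56,15,23,43,60],
  [7,25,15,23,39,57,59,61],
  [7,56,15,23,57,58,47,55],
  [7,56,15,23,57,58,47,61],
  [7,11,19],
  [7,11,13],
  [7,11,21],
  [7,11,49],
  [7,11,28],
  [7,25,42],
  [7,11,52,61],
  [7,11,52,31,59],
  [7,11,52,53],
  [7,11,52,23,47],
  [7,11,52,60,31],
  [7,11,52,60,59],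
  [3],
  [1]]

/-- The characteristic nonFC-families over `{0, …, 5}` (one from each isomorphism class of
maximal nonFC-families), one family per line, each given by its irreducible members. -/
def ncSixTable : List (List ℕ) := [
  [15,23,27,29,62],
  [15,23,39,27,61,62],
  [15,23,43,51,61,62],
  [15,23,43,53,59,61,62],
  [15,23,27,45,55,59,61,62],
  [15,23,43,60,55,59,61,62],
  [15,23,57,58,47,55,61,62],
  [15,23,27,60,47,55,59,61,62],
  [15,23,27,45,46],
  [15,23,27,45,60],
  [15,23,43,51,60],
  [15,23,43,53,58],
  [15,23,39,27,60,61],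
  [15,23,27,45,54,59],
  [15,23,39,27,43,53],
  [15,23,39,27,45,57],
  [15,23,27,45,53,57],
  [7,27,45,62],
  [7,27,29,59,61,62],
  [7,27,57,47,61,62],
  [7,15,27,55,59,61,62],
  [7,27,60,47,59,61,62],
  [7,15,51,31,47,59,61,62],
  [7,27,43,29,61],
  [7,27,29,58,61],
  [7,27,57,60,47],
  [7,15,27,57,61,62],
  [7,15,51,57,61,62],
  [7,27,43,57,55,61],
  [7,15,23,27,47,61,62],
  [7,15,23,27,59,61,62],
  [7,15,23,43,55,61,62],
  [7,15,23,43,59,61,62],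
  [7,15,27,60,47,61,62],
  [7,15,27,60,59,61,62],
  [7,15,51,60,31,61,62],
  [7,15,51,60,59,61,62],
  [7,15,27,60,47,55,59,61],
  [7,15,51,60,31,47,59,61],
  [7,15,57,58,31,55,61,62],
  [7,15,27,43,53],
  [7,15,27,43,60],
  [7,15,27,51,45],
  [7,15,27,51,53],
  [7,15,27,51,60],
  [7,15,27,57,60],
  [7,15,51,57,58],
  [7,15,51,57,60],
  [7,15,23,43,57,62],
  [7,15,27,43,57,61],
  [7,15,27,51,57,61],
  [7,15,27,45,57,55],
  [7,15,27,53,57,47],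
  [7,15,23,43,60,55,61],
  [7,15,23,43,60,59,61],
  [7,15,23,57,58,61,62],
  [7,15,51,53,57,31,47],
  [7,15,23,39,57,59,61,62],
  [7,15,23,27,60,47,55,61],
  [7,15,23,27,60,47,59,61],
  [7,15,23,57,58,47,55,61],
  [7,15,23,39,57,58],
  [7,15,23,27,45,57],
  [7,15,23,43,51,57],
  [7,15,23,39,27,57,61],
  [7,15,23,39,27,60,59],
  [7,15,23,27,43,57,55],
  [7,15,23,39,27,29,59,61],
  [7,15,23,39,27,45,59,61],
  [7,25,47,59,62],
  [7,25,46,55],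
  [7,11,53,31,59],
  [7,11,53,31,61],
  [7,11,60,55,59],
  [7,11,60,31,47,55],
  [7,25,39,47,55,62],
  [7,56,15,31,55,59,61,62],
  [7,11,23,57],
  [7,25,15,43],
  [7,25,15,54],
  [7,25,39,58],
  [7,11,23,53,47],
  [7,11,23,60,47],
  [7,11,23,60,55],
  [7,25,15,39,62],
  [7,25,15,46,62],
  [7,25,15,57,47,62],
  [7,25,39,57,47,62],
  [7,56,15,51,31,61],
  [7,25,15,27,47,55,61],
  [7,25,39,43,57],
  [7,56,15,27,43],
  [7,56,15,23,27,61],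
  [7,56,15,27,60,47],
  [7,56,15,27,60,61],
  [7,56,15,51,60,31],
  [7,25,15,23,39,59,61],
  [7,56,15,27,57,47,61],
  [7,25,15,39,57,55,59,61],
  [7,56,15,23,57,47,59,62],
  [7,56,15,23,57,59,61,62],
  [7,25,15,23,57,47,55,59,61],
  [7,56,15,23,39,27],
  [7,56,15,23,27,57],
  [7,11,23,39,27,43,61],
  [7,56,15,23,39,57,62],
  [7,56,15,23,57,58,47],
  [7,56,15,23,39,57,59,61],
  [7,11,23,39,27,43,51],
  [7,25,15,23,39,27,57],
  [7,11,52,59],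
  [7,11,52,31,47],
  [7,11,52,23],
  [7,11,52,27],
  [7,11,52,60]]

/-- The collection of the characteristic FC-families over `{0, …, 5}`. -/
def FcSix : Finset (Finset (Finset ℕ)) :=
  (fcSixTable.map familyOfCodes).toFinset

/-- The collection of the characteristic nonFC-families over `{0, …, 5}`. -/
def NcSix : Finset (Finset (Finset ℕ)) :=
  (ncSixTable.map familyOfCodes).toFinset

/-! Both halves reduce to finite checks on families of subsets of {0,…,5}, coded by numbers below
64, and a certificate is given for each family of the tables.

FC-families (`isFC_of_weights`). Split a union-closed F containing the given family by the part B of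
its members outside {0,…,5}. The traces in one layer form a union-closed family G that absorbs every
member of the given family. Suppose that for some weights w, positive only on elements of the given
family and not all zero, every such G has average weight at least half of the total weight W.
Summing over the layers gives the same bound for F. Since the weight of F is the sum of w(a) times
the number of occurrences of a, not all elements of the given family can be rare.

There are too many families G to list, so they are searched by branch and bound (`runSearch_sound`).
A node prescribes some members of G and some non-members. It is closed by a flow (`visit_sound`,
`le_sum_of_visit`): a light member A of G sends its deficit W - 2w(A) to heavy sets D ∪ A with D
absorbed by G. These sets also lie in G, so one flow serves all G at the node. What cannot be sent
must be covered by the surplus of the prescribed members. The certificate consists of the weights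
and the branching codes; the flow is found greedily.

NonFC-families (`isNonFC_of_codes`). Take absorbing union-closed families, with multiplicities, in
which each relevant element is rare on average. With new elements 6, 7, … they become layers of one
union-closed family: each layer carries all new elements but one, a further layer carries all new
elements and every subset of {0,…,5}, and a last layer without new elements holds the closure of the
given family. The full layer contains each element exactly in half of its members, so rarity
survives. The claim on closures follows because a union-closed family contains a family iff it
contains its closure. -/

/-! ### Subsets of {0,…,5} as numbers below 64. -/

theorem mem_setOfCode {m a : ℕ} : a ∈ setOfCode m ↔ a < 6 ∧ m.testBit a = true := by
  simp [setOfCode]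

theorem setOfCode_lor (m n : ℕ) : setOfCode (m ||| n) = setOfCode m ∪ setOfCode n := by
  ext a
  simp only [Finset.mem_union, mem_setOfCode, Nat.testBit_or, Bool.or_eq_true]
  tauto

theorem setOfCode_subset_range (m : ℕ) : setOfCode m ⊆ Finset.range 6 :=
  Finset.filter_subset _ _

theorem testBit_eq_false_of_lt {m a : ℕ} (hm : m < 64) (ha : 6 ≤ a) : m.testBit a = false :=
  Nat.testBit_lt_two_pow (hm.trans_le (Nat.pow_le_pow_right (by norm_num) ha : 2 ^ 6 ≤ 2 ^ a))

theorem setOfCode_injOn : Set.InjOn setOfCode {m | m < 64} := by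
  intro m hm n hn h
  refine Nat.eq_of_testBit_eq fun a => ?_
  rcases lt_or_ge a 6 with ha | ha
  · have := congrArg (a ∈ ·) h
    simp only [mem_setOfCode, ha, true_and, eq_iff_iff] at this
    exact Bool.eq_iff_iff.2 this
  · rw [testBit_eq_false_of_lt hm ha, testBit_eq_false_of_lt hn ha]

theorem image_setOfCode_range :
    (Finset.range 64).image setOfCode = (Finset.range 6).powerset := by
  refine Finset.eq_of_subset_of_card_le ?_ ?_
  · intro S hS
    obtain ⟨m, -, rfl⟩ := Finset.mem_image.1 hS
    exact Finset.mem_powerset.2 (setOfCode_subset_range m)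
  · rw [Finset.card_powerset, Finset.card_range, Finset.card_image_of_injOn]
    · simp
    · exact setOfCode_injOn.mono fun m hm => by simpa using hm

theorem exists_setOfCode_eq {S : Finset ℕ} (hS : S ⊆ Finset.range 6) :
    ∃ m < 64, setOfCode m = S := by
  have := Finset.mem_powerset.2 hS
  rw [← image_setOfCode_range] at this
  simpa using this

theorem lor_lt_64 {m n : ℕ} (hm : m < 64) (hn : n < 64) : m ||| n < 64 :=
  Nat.or_lt_two_pow (n := 6) hm hn

theorem mem_familyOfCodes {l : List ℕ} {S : Finset ℕ} :
    S ∈ familyOfCodes l ↔ ∃ m ∈ l, setOfCode m = S := by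
  simp [familyOfCodes]

/-! ### Families of codes as bit masks, and distinctness of the listed families. -/

/-- The family of the codes `m < 64` for which the bit `m` of `g` is set. -/
def codesOfMask (g : ℕ) : Finset ℕ :=
  (Finset.range 64).filter fun m => g.testBit m = true

theorem mem_codesOfMask {g m : ℕ} : m ∈ codesOfMask g ↔ m < 64 ∧ g.testBit m = true := by
  simp [codesOfMask]

/-- The mask of a list of codes. -/
def maskOfCodes (l : List ℕ) : ℕ :=
  l.foldr (fun m g => g ||| 2 ^ m) 0

theorem testBit_maskOfCodes (l : List ℕ) (m : ℕ) :
    (maskOfCodes l).testBit m = true ↔ m ∈ l := by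
  induction l with
  | nil => simp [maskOfCodes]
  | cons a l ih =>
    have : maskOfCodes (a :: l) = maskOfCodes l ||| 2 ^ a := rfl
    rw [this, Nat.testBit_or, Nat.testBit_two_pow, Bool.or_eq_true, ih]
    simp [eq_comm, or_comm]

/-- The mask forgets order and repetition in the list, so it is an invariant of the family.
Distinctness of families thereby becomes distinctness of numbers. -/
theorem maskOfCodes_eq_of_familyOfCodes_eq {k l : List ℕ} (hk : ∀ m ∈ k, m < 64)
    (hl : ∀ m ∈ l, m < 64) (h : familyOfCodes k = familyOfCodes l) :
    maskOfCodes k = maskOfCodes l := by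
  have key : ∀ {k l : List ℕ}, (∀ m ∈ k, m < 64) → (∀ m ∈ l, m < 64) →
      familyOfCodes k = familyOfCodes l → ∀ m ∈ k, m ∈ l := by
    intro k l hk hl h m hm
    have : setOfCode m ∈ familyOfCodes l := h ▸ mem_familyOfCodes.2 ⟨m, hm, rfl⟩
    obtain ⟨n, hn, e⟩ := mem_familyOfCodes.1 this
    rwa [← setOfCode_injOn (hl n hn) (hk m hm) e]
  refine Nat.eq_of_testBit_eq fun m => Bool.eq_iff_iff.2 ?_
  rw [testBit_maskOfCodes, testBit_maskOfCodes]
  exact ⟨key hk hl h m, key hl hk h.symm m⟩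

/-- Lists of codes with pairwise distinct masks give distinct families. -/
theorem card_toFinset_map_familyOfCodes {t : List (List ℕ)} (ht : ∀ l ∈ t, ∀ m ∈ l, m < 64)
    (hd : (t.map maskOfCodes).Nodup) : (t.map familyOfCodes).toFinset.card = t.length := by
  rw [List.toFinset_card_of_nodup, List.length_map]
  refine List.Nodup.map_on ?_ hd.of_map
  intro k hk l hl h
  exact List.inj_on_of_nodup_map hd hk hl
    (maskOfCodes_eq_of_familyOfCodes_eq (ht k hk) (ht l hl) h)

/-! ### Layers of a union-closed family and the weight criterion for FC-families. -/

/-- The sum of the weights of the elements of the set coded by `m`. -/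
def codeWeight (w : ℕ → ℕ) (m : ℕ) : ℕ :=
  ∑ a ∈ setOfCode m, w a

/-- The codes of the traces on `{0, …, 5}` of the members of `F` whose other part is `B`. -/
def layerCodes (F : Finset (Finset ℕ)) (B : Finset ℕ) : Finset ℕ :=
  (Finset.range 64).filter fun m => setOfCode m ∪ B ∈ F

theorem mem_layerCodes {F : Finset (Finset ℕ)} {B : Finset ℕ} {m : ℕ} :
    m ∈ layerCodes F B ↔ m < 64 ∧ setOfCode m ∪ B ∈ F := by
  simp [layerCodes]

theorem UnionClosed.union_mem {F : Finset (Finset ℕ)} (hF : UnionClosed F) {A B : Finset ℕ}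
    (hA : A ∈ F) (hB : B ∈ F) : A ∪ B ∈ F :=
  hF hA hB

theorem union_sdiff_range {m : ℕ} {B : Finset ℕ} (hB : Disjoint B (Finset.range 6)) :
    (setOfCode m ∪ B) \ Finset.range 6 = B := by
  rw [Finset.union_sdiff_distrib, Finset.sdiff_eq_empty_iff_subset.2 (setOfCode_subset_range m),
    Finset.empty_union, hB.sdiff_eq_left]

theorem union_inter_range {m : ℕ} {B : Finset ℕ} (hB : Disjoint B (Finset.range 6)) :
    (setOfCode m ∪ B) ∩ Finset.range 6 = setOfCode m := by
  rw [Finset.union_inter_distrib_right, Finset.disjoint_iff_inter_eq_empty.1 hB, Finset.union_empty,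
    Finset.inter_eq_left.2 (setOfCode_subset_range m)]

theorem union_injOn {B : Finset ℕ} (hB : Disjoint B (Finset.range 6)) :
    Set.InjOn (fun m => setOfCode m ∪ B) {m | m < 64} := by
  intro m hm n hn h
  refine setOfCode_injOn hm hn ?_
  have := congrArg (· ∩ Finset.range 6) h
  simpa only [union_inter_range hB] using this

theorem filter_sdiff_eq_image_layerCodes (F : Finset (Finset ℕ)) {B : Finset ℕ}
    (hB : Disjoint B (Finset.range 6)) :
    (F.filter fun X => X \ Finset.range 6 = B) =
      (layerCodes F B).image fun m => setOfCode m ∪ B := by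
  ext X
  simp only [Finset.mem_filter, Finset.mem_image, mem_layerCodes]
  constructor
  · rintro ⟨hX, rfl⟩
    obtain ⟨m, hm, e⟩ := exists_setOfCode_eq (Finset.inter_subset_right : X ∩ Finset.range 6 ⊆ _)
    have e' : setOfCode m ∪ X \ Finset.range 6 = X := by
      rw [e, Finset.union_comm, Finset.sdiff_union_inter]
    exact ⟨m, ⟨hm, by rwa [e']⟩, e'⟩
  · rintro ⟨m, ⟨-, hm⟩, rfl⟩
    exact ⟨hm, union_sdiff_range hB⟩

/-- A sum over a family is the sum over its layers. -/
theorem sum_eq_sum_layerCodes (F : Finset (Finset ℕ)) (f : Finset ℕ → ℕ) :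
    ∑ X ∈ F, f X = ∑ B ∈ F.image (· \ Finset.range 6),
      ∑ m ∈ layerCodes F B, f (setOfCode m ∪ B) := by
  rw [← Finset.sum_fiberwise_of_maps_to (g := (· \ Finset.range 6))
    (fun X hX => Finset.mem_image_of_mem _ hX)]
  refine Finset.sum_congr rfl fun B hB => ?_
  obtain ⟨X, -, rfl⟩ := Finset.mem_image.1 hB
  have hd : Disjoint (X \ Finset.range 6) (Finset.range 6) := Finset.sdiff_disjoint
  rw [filter_sdiff_eq_image_layerCodes F hd, Finset.sum_image]
  exact (union_injOn hd).mono fun m hm => (mem_layerCodes.1 hm).1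

/-- A set of codes below `64` that is closed under unions. -/
structure UnionClosedCodes (G : Finset ℕ) : Prop where
  lt : ∀ A ∈ G, A < 64
  lor_mem : ∀ A ∈ G, ∀ B ∈ G, A ||| B ∈ G

/-- Two members with the same outer part B have a union with outer part B, so unions stay within the
layer. -/
theorem unionClosedCodes_layerCodes {F : Finset (Finset ℕ)} (hF : UnionClosed F)
    (B : Finset ℕ) : UnionClosedCodes (layerCodes F B) where
  lt A hA := (mem_layerCodes.1 hA).1
  lor_mem A hA A' hA' := by
    obtain ⟨h1, h2⟩ := mem_layerCodes.1 hA
    obtain ⟨h3, h4⟩ := mem_layerCodes.1 hA'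
    refine mem_layerCodes.2 ⟨lor_lt_64 h1 h3, ?_⟩
    rw [setOfCode_lor, Finset.union_union_distrib_right]
    exact hF.union_mem h2 h4

/-- Poonen's criterion: a family is an FC-family if some weights on its elements make the average
weight in each union-closed family that absorbs it at least half of the total weight. -/
theorem isFC_of_weights {l : List ℕ} (hl : ∀ D ∈ l, D < 64) (w : ℕ → ℕ)
    (hw : ∀ a < 6, 0 < w a → a ∈ (familyOfCodes l).biUnion id) (hpos : ∃ a < 6, 0 < w a)
    (h : ∀ G : Finset ℕ, UnionClosedCodes G → (∀ D ∈ l, ∀ A ∈ G, A ||| D ∈ G) →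
      (∑ a ∈ Finset.range 6, w a) * G.card ≤ ∑ A ∈ G, 2 * codeWeight w A) :
    IsFC (familyOfCodes l) := by
  intro F hF hlF
  by_contra hcon
  have hlt : ∀ a ∈ (familyOfCodes l).biUnion id, 2 * occurrences a F < F.card := by
    intro a ha
    by_contra hge
    refine hcon ⟨a, ha, ?_, not_lt.1 hge⟩
    exact Finset.biUnion_subset_biUnion_of_subset_left _ hlF ha
  have hweight : ∀ X : Finset ℕ, ∑ a ∈ X ∩ Finset.range 6, w a =
      ∑ a ∈ Finset.range 6, if a ∈ X then w a else 0 := by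
    intro X
    rw [← Finset.sum_filter, Finset.filter_mem_eq_inter, Finset.inter_comm]
  have hlower : (∑ a ∈ Finset.range 6, w a) * F.card ≤
      ∑ X ∈ F, 2 * ∑ a ∈ X ∩ Finset.range 6, w a := by
    -- Both the weight of F and its cardinality are split into layers; the bound then holds layer by
    -- layer.
    rw [sum_eq_sum_layerCodes, Finset.card_eq_sum_ones, sum_eq_sum_layerCodes, Finset.mul_sum]
    refine Finset.sum_le_sum fun B hB => ?_
    obtain ⟨X, -, rfl⟩ := Finset.mem_image.1 hB
    have hd : Disjoint (X \ Finset.range 6) (Finset.range 6) := Finset.sdiff_disjoint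
    rw [← Finset.card_eq_sum_ones]
    refine (h _ (unionClosedCodes_layerCodes hF _) ?_).trans_eq ?_
    -- A member of the given family has no outer part, so a union with it does not leave the layer.
    · intro D hD A hA
      obtain ⟨h1, h2⟩ := mem_layerCodes.1 hA
      refine mem_layerCodes.2 ⟨lor_lt_64 h1 (hl D hD), ?_⟩
      rw [setOfCode_lor, Finset.union_right_comm]
      exact hF.union_mem h2 (hlF (mem_familyOfCodes.2 ⟨D, hD, rfl⟩))
    · refine Finset.sum_congr rfl fun m _ => ?_
      rw [union_inter_range hd]
      rfl
  -- Double counting of the pairs of a member X and an element a of X.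
  have hupper : ∑ X ∈ F, 2 * ∑ a ∈ X ∩ Finset.range 6, w a =
      ∑ a ∈ Finset.range 6, w a * (2 * occurrences a F) := by
    simp only [hweight]
    rw [← Finset.mul_sum, Finset.sum_comm, Finset.mul_sum]
    refine Finset.sum_congr rfl fun a _ => ?_
    rw [← Finset.sum_filter, Finset.sum_const, smul_eq_mul, occurrences]
    ring
  -- Elements of weight 0 may be frequent, but contribute nothing. One element of positive weight
  -- makes the inequality strict.
  have hstrict : ∑ a ∈ Finset.range 6, w a * (2 * occurrences a F) <
      ∑ a ∈ Finset.range 6, w a * F.card := by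
    obtain ⟨a, ha, hwa⟩ := hpos
    refine Finset.sum_lt_sum (fun b hb => ?_) ⟨a, Finset.mem_range.2 ha, ?_⟩
    · rcases Nat.eq_zero_or_pos (w b) with h0 | h0
      · simp [h0]
      · exact Nat.mul_le_mul_left _ (hlt b (hw b (Finset.mem_range.1 hb) h0)).le
    · exact Nat.mul_lt_mul_of_pos_left (hlt a (hw a ha hwa)) hwa
  rw [← Finset.sum_mul] at hstrict
  omega

theorem biUnion_familyOfCodes_subset (l : List ℕ) :
    (familyOfCodes l).biUnion id ⊆ Finset.range 6 := by
  intro a ha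
  obtain ⟨S, hS, haS⟩ := Finset.mem_biUnion.1 ha
  obtain ⟨m, -, rfl⟩ := mem_familyOfCodes.1 hS
  exact setOfCode_subset_range m haS

/-! ### Gluing families of codes into one union-closed family in which given elements are rare. -/

/-- The new elements of the sets of the layer `j`: all of `6, …, 5 + n` except `6 + j` if `j < n`,
all of them if `j = n`, none of them if `j = n + 1`. -/
def layerBase (n j : ℕ) : Finset ℕ :=
  if j = n + 1 then ∅ else (Finset.Ico 6 (6 + n)).erase (6 + j)

/-- The family whose layer `j` consists of the sets `A ∪ layerBase n j` for the codes of `A` in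
`G j`. -/
def layeredFamily (n : ℕ) (G : ℕ → Finset ℕ) : Finset (Finset ℕ) :=
  (Finset.range (n + 2)).biUnion fun j => (G j).image fun m => setOfCode m ∪ layerBase n j

theorem mem_layeredFamily {n : ℕ} {G : ℕ → Finset ℕ} {X : Finset ℕ} :
    X ∈ layeredFamily n G ↔
      ∃ j < n + 2, ∃ m ∈ G j, setOfCode m ∪ layerBase n j = X := by
  simp [layeredFamily]

theorem mem_layerBase {n j x : ℕ} :
    x ∈ layerBase n j ↔ j ≠ n + 1 ∧ x ≠ 6 + j ∧ 6 ≤ x ∧ x < 6 + n := by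
  unfold layerBase
  split_ifs with h <;> simp [h]

theorem disjoint_layerBase (n j : ℕ) : Disjoint (layerBase n j) (Finset.range 6) := by
  rw [Finset.disjoint_left]
  intro x hx
  have := mem_layerBase.1 hx
  simp only [Finset.mem_range]
  omega

/-- With n = 1 the layers 0 and 2 would both have the empty base, hence the bound on n. -/
theorem layerBase_injOn {n : ℕ} (hn : 2 ≤ n) : Set.InjOn (layerBase n) {j | j < n + 2} := by
  intro i hi j hj h
  have key : ∀ x, x ∈ layerBase n i ↔ x ∈ layerBase n j := fun x => by rw [h]
  simp only [mem_layerBase] at key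
  simp only [Set.mem_ofPred_eq] at hi hj
  by_contra hne
  -- A base that omits at most one new element contains 6 or 7, unlike the empty base. The elements
  -- 6 + i and 6 + j separate the other bases from each other.
  have h0 := key 6
  have h1 := key 7
  have h2 := key (6 + i)
  have h3 := key (6 + j)
  omega

theorem layerBase_union_of_ne {n i j : ℕ} (hi : i < n + 1) (hj : j < n + 1) (hne : i ≠ j) :
    layerBase n i ∪ layerBase n j = layerBase n n := by
  ext x
  simp only [Finset.mem_union, mem_layerBase]
  omega

theorem layerBase_last (n : ℕ) : layerBase n (n + 1) = ∅ := by
  simp [layerBase]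

/-- Different layers are disjoint because their bases differ. The functions of interest ignore the
new elements, so each layer counts like its family of codes. -/
theorem sum_layeredFamily {n : ℕ} (hn : 2 ≤ n) {G : ℕ → Finset ℕ} (hG : ∀ j, ∀ m ∈ G j, m < 64)
    (f : Finset ℕ → ℕ) (hf : ∀ m j, f (setOfCode m ∪ layerBase n j) = f (setOfCode m)) :
    ∑ X ∈ layeredFamily n G, f X =
      ∑ j ∈ Finset.range (n + 2), ∑ m ∈ G j, f (setOfCode m) := by
  unfold layeredFamily
  rw [Finset.sum_biUnion]
  · refine Finset.sum_congr rfl fun j _ => ?_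
    rw [Finset.sum_image]
    · exact Finset.sum_congr rfl fun m _ => hf m j
    · exact (union_injOn (disjoint_layerBase n j)).mono fun m hm => hG j m hm
  · intro i hi j hj hne
    rw [Function.onFun, Finset.disjoint_left]
    intro X hXi hXj
    obtain ⟨m, -, rfl⟩ := Finset.mem_image.1 hXi
    obtain ⟨m', -, e⟩ := Finset.mem_image.1 hXj
    refine hne (layerBase_injOn hn (by simpa using hi) (by simpa using hj) ?_)
    have := congrArg (· \ Finset.range 6) e
    simpa only [union_sdiff_range (disjoint_layerBase n _)] using this.symm

/-- Within a layer this is closure of that layer. Two different layers up to n lack no common new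
element, so the union falls into layer n, which has every code. A set of layer n + 1 brings no new
elements and is absorbed by the other layer. -/
theorem unionClosed_layeredFamily {n : ℕ} {G : ℕ → Finset ℕ} (hG : ∀ j, UnionClosedCodes (G j))
    (hfull : ∀ m < 64, m ∈ G n)
    (habs : ∀ j, ∀ D ∈ G (n + 1), ∀ A ∈ G j, A ||| D ∈ G j) :
    UnionClosed (layeredFamily n G) := by
  -- Only the first index may be n + 1 here; by symmetry of the union this leaves just the case that
  -- both are n + 1.
  have key : ∀ i j, i < n + 2 → j < n + 1 → ∀ A ∈ G i, ∀ B ∈ G j,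
      (setOfCode A ∪ layerBase n i) ∪ (setOfCode B ∪ layerBase n j) ∈ layeredFamily n G := by
    intro i j hi hj A hA B hB
    rw [Finset.union_union_union_comm, ← setOfCode_lor]
    rcases eq_or_ne i j with rfl | hne
    · rw [Finset.union_self]
      exact mem_layeredFamily.2 ⟨i, hi, _, (hG i).lor_mem A hA B hB, rfl⟩
    · rcases eq_or_ne i (n + 1) with rfl | hi'
      · rw [layerBase_last, Finset.empty_union, Nat.or_comm]
        exact mem_layeredFamily.2 ⟨j, by omega, _, habs j A hA B hB, rfl⟩
      · rw [layerBase_union_of_ne (by omega) hj hne]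
        exact mem_layeredFamily.2 ⟨n, by omega, _,
          hfull _ (lor_lt_64 ((hG i).lt A hA) ((hG j).lt B hB)), rfl⟩
  intro X hX Y hY
  obtain ⟨i, hi, A, hA, rfl⟩ := mem_layeredFamily.1 hX
  obtain ⟨j, hj, B, hB, rfl⟩ := mem_layeredFamily.1 hY
  rw [Finset.sup_eq_union]
  rcases eq_or_ne j (n + 1) with rfl | hj'
  · rcases eq_or_ne i (n + 1) with rfl | hi'
    · rw [Finset.union_union_union_comm, ← setOfCode_lor, Finset.union_self]
      exact mem_layeredFamily.2 ⟨n + 1, hi, _, (hG _).lor_mem A hA B hB, rfl⟩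
    · rw [Finset.union_comm]
      exact key _ i hj (by omega) B hB A hA
  · exact key i j hi (by omega) A hA B hB

/-- The codes in `G` of the sets that contain `a`. -/
def codesContaining (a : ℕ) (G : Finset ℕ) : Finset ℕ :=
  G.filter fun m => m.testBit a = true

theorem card_codesContaining_range : ∀ a < 6, (codesContaining a (Finset.range 64)).card = 32 := by
  decide +kernel

/-- A family is a nonFC-family if there are union-closed families of codes which absorb a
union-closed family `H` containing it, and in which every element is rare on average, so much that
this outweighs the occurrences in `H`. -/
theorem isNonFC_of_codes {l : List ℕ} {H : Finset ℕ} {L : List (Finset ℕ)}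
    (hn : 2 ≤ L.length) (hlH : ∀ D ∈ l, D ∈ H) (hH : UnionClosedCodes H)
    (hL : ∀ G ∈ L, UnionClosedCodes G) (habs : ∀ G ∈ L, ∀ D ∈ H, ∀ A ∈ G, A ||| D ∈ G)
    (hrare : ∀ a ∈ (familyOfCodes l).biUnion id,
      2 * ((L.map fun G => (codesContaining a G).card).sum + (codesContaining a H).card) <
        (L.map Finset.card).sum + H.card) :
    IsNonFC (familyOfCodes l) := by
  intro hFC
  set n := L.length with hndef
  -- The index n gets the full family and n + 1 gets H. The default ∅ beyond is in no layer, but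
  -- satisfies the hypotheses that are stated for all j.
  let G : ℕ → Finset ℕ := fun j => (L ++ [Finset.range 64, H]).getD j ∅
  have hGlt : ∀ j (hj : j < n), G j = L[j] := fun j hj => by
    simp only [G]
    rw [List.getD_append _ _ _ _ hj, List.getD_eq_getElem _ _ hj]
  have hGn : G n = Finset.range 64 := by
    simp only [G]
    rw [List.getD_append_right _ _ _ _ le_rfl]
    simp
  have hGn1 : G (n + 1) = H := by
    simp only [G]
    rw [List.getD_append_right _ _ _ _ (by omega)]
    simp [hndef]
  have hGgt : ∀ j, n + 2 ≤ j → G j = ∅ := fun j hj => by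
    simp only [G]
    exact List.getD_eq_default _ _ (by simpa using hj)
  have hcases : ∀ P : Finset ℕ → Prop, (∀ G ∈ L, P G) → P (Finset.range 64) → P H → P ∅ →
      ∀ j, P (G j) := by
    intro P h1 h2 h3 h4 j
    rcases lt_or_ge j n with hj | hj
    · rw [hGlt j hj]
      exact h1 _ (List.getElem_mem hj)
    · rcases eq_or_ne j n with rfl | hj1
      · rwa [hGn]
      · rcases eq_or_ne j (n + 1) with rfl | hj2
        · rwa [hGn1]
        · rwa [hGgt j (by omega)]
  have hfull : UnionClosedCodes (Finset.range 64) :=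
    ⟨fun A hA => Finset.mem_range.1 hA, fun A hA B hB =>
      Finset.mem_range.2 (lor_lt_64 (Finset.mem_range.1 hA) (Finset.mem_range.1 hB))⟩
  have hG : ∀ j, UnionClosedCodes (G j) :=
    hcases _ hL hfull hH ⟨fun A hA => by simp at hA, fun A hA => by simp at hA⟩
  have hGabs : ∀ j, ∀ D ∈ G (n + 1), ∀ A ∈ G j, A ||| D ∈ G j := by
    rw [hGn1]
    refine hcases (fun K => ∀ D ∈ H, ∀ A ∈ K, A ||| D ∈ K) habs ?_ ?_ ?_
    · exact fun D hD A hA => Finset.mem_range.2 (lor_lt_64 (Finset.mem_range.1 hA) (hH.lt D hD))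
    · exact fun D hD A hA => hH.lor_mem A hA D hD
    · exact fun D _ A hA => by simp at hA
  have hclosed : UnionClosed (layeredFamily n G) :=
    unionClosed_layeredFamily hG (fun m hm => by rw [hGn]; exact Finset.mem_range.2 hm) hGabs
  have hsub : familyOfCodes l ⊆ layeredFamily n G := by
    intro S hS
    obtain ⟨m, hm, rfl⟩ := mem_familyOfCodes.1 hS
    refine mem_layeredFamily.2 ⟨n + 1, by omega, m, by rw [hGn1]; exact hlH m hm, ?_⟩
    rw [layerBase_last, Finset.union_empty]
  obtain ⟨a, ha, -, hle⟩ := hFC _ hclosed hsub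
  have ha6 : a < 6 := Finset.mem_range.1 (biUnion_familyOfCodes_subset l ha)
  have hsum : ∀ φ : Finset ℕ → ℕ, ∑ j ∈ Finset.range (n + 2), φ (G j) =
      (L.map φ).sum + φ (Finset.range 64) + φ H := by
    intro φ
    rw [Finset.sum_range_succ, Finset.sum_range_succ, hGn, hGn1, Finset.sum_range,
      ← Fin.sum_univ_fun_getElem L φ]
    congr 2
    exact Finset.sum_congr rfl fun j _ => by rw [hGlt j j.2]
  have hcard : (layeredFamily n G).card = (L.map Finset.card).sum + 64 + H.card := by
    rw [Finset.card_eq_sum_ones, sum_layeredFamily hn (fun j => (hG j).lt) _ fun _ _ => rfl]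
    simp only [← Finset.card_eq_sum_ones]
    rw [hsum Finset.card, Finset.card_range]
  have hocc : occurrences a (layeredFamily n G) =
      (L.map fun K => (codesContaining a K).card).sum + 32 + (codesContaining a H).card := by
    rw [occurrences, Finset.card_filter, sum_layeredFamily hn (fun j => (hG j).lt)]
    · have : ∀ K : Finset ℕ, (∑ m ∈ K, if a ∈ setOfCode m then 1 else 0) =
          (codesContaining a K).card := by
        intro K
        simp only [codesContaining, Finset.card_filter, mem_setOfCode, ha6, true_and]
      simp only [this]
      rw [hsum fun K => (codesContaining a K).card, card_codesContaining_range a ha6]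
    · intro m j
      have : a ∉ layerBase n j := fun h =>
        Finset.disjoint_left.1 (disjoint_layerBase n j) h (Finset.mem_range.2 ha6)
      simp [this]
  -- The full layer adds 64 members and 32 occurrences of a, so it cancels from the comparison with
  -- one half.
  have := hrare a ha
  omega

/-! ### Passing to the closure. -/

/-- The subsets of ⋃ F form a union-closed collection that contains F, hence its closure. -/
theorem biUnion_unionClosure (F : Finset (Finset ℕ)) :
    (unionClosure F).biUnion id ⊆ F.biUnion id := by
  intro a ha
  obtain ⟨S, hS, haS⟩ := Finset.mem_biUnion.1 ha
  rw [unionClosure, Set.Finite.mem_toFinset] at hS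
  have : supClosure (F : Set (Finset ℕ)) ⊆ {S | S ⊆ F.biUnion id} := by
    refine supClosure_min (fun S hS => Finset.subset_biUnion_of_mem id hS) ?_
    exact fun S hS T hT => Finset.union_subset hS hT
  exact this hS haS

/-- The closure of a nonFC-family is a nonFC-family. -/
theorem IsNonFC.unionClosure {F : Finset (Finset ℕ)} (hF : IsNonFC F) :
    IsNonFC (unionClosure F) := by
  refine fun h => hF fun K hK hFK => ?_
  -- The family K is union-closed and contains F, so it contains the closure of F by minimality.
  obtain ⟨a, ha, hfr⟩ := h K hK fun S hS => by
    rw [_root_.unionClosure, Set.Finite.mem_toFinset] at hS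
    exact supClosure_min (by exact_mod_cast hFK) hK hS
  exact ⟨a, biUnion_unionClosure F ha, hfr⟩

/-! ### Functions for the kernel

The kernel evaluates functions fastest that are given by recursors. -/

/-- The function `List.foldr`, given by the recursor. -/
noncomputable def foldList {α β : Type} (f : α → β → β) (b : β) (l : List α) : β :=
  @List.rec α (fun _ => β) b (fun a _ s => f a s) l

/-- The function `List.all`, given by the recursor. -/
noncomputable def allList {α : Type} (l : List α) (p : α → Bool) : Bool :=
  @List.rec α (fun _ => Bool) true (fun a _ b => @Bool.rec (fun _ => Bool) false b (p a)) l

theorem allList_eq_true {α : Type} {l : List α} {p : α → Bool} :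
    allList l p = true ↔ ∀ a ∈ l, p a = true := by
  induction l with
  | nil => exact ⟨fun _ a ha => absurd ha List.not_mem_nil, fun _ => rfl⟩
  | cons a l ih =>
    rw [List.forall_mem_cons, ← ih]
    change @Bool.rec (fun _ => Bool) false (allList l p) (p a) = true ↔ _
    cases p a <;> simp

/-! ### Masks of families of codes -/

/-- If the bits of `mask` are the codes which contain a bit `k` and `s = 2 ^ k`, this maps the mask
of a family `J` to the mask of the family of all `D ||| s` with `D` in `J`. -/
def adjoin (s mask J : ℕ) : ℕ :=
  Nat.land (Nat.lor J (Nat.shiftLeft J s)) mask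

/-- The pairs of `2 ^ k` and the mask of the codes below `64` that contain the bit `k`. -/
def bitPlanes : List (ℕ × ℕ) :=
  [(32, 18446744069414584320), (16, 18446462603027742720), (8, 18374966859414961920),
    (4, 17361641481138401520), (2, 14757395258967641292), (1, 12297829382473034410)]

theorem bitPlanes_spec : ∀ t ∈ bitPlanes, ∃ k < 6, t.1 = 2 ^ k ∧ t.2 < 2 ^ 64 ∧
    ∀ m < 64, t.2.testBit m = m.testBit k := by
  decide +kernel

/-- These two finite facts justify `adjoin`. A code without the bit k is moved by the shift by 2 ^ k
to its union with {k}, and a code with this bit stays. Shifting a code that already has the bit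
clears it, so the plane mask erases that image. -/
theorem lor_two_pow_of_testBit : ∀ k < 6, ∀ m < 64, m.testBit k = true →
    2 ^ k ≤ m ∧ (m - 2 ^ k) ||| 2 ^ k = m ∧ m ||| 2 ^ k = m := by
  decide +kernel

theorem testBit_lor_two_pow : ∀ k < 6, ∀ m < 64, (m ||| 2 ^ k).testBit k = true ∧
    (m ||| 2 ^ k = m ∨ 2 ^ k ≤ m ||| 2 ^ k ∧ (m ||| 2 ^ k) - 2 ^ k = m) := by
  decide +kernel

theorem testBit_adjoin {s mask J m : ℕ} : (adjoin s mask J).testBit m = true ↔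
    (J.testBit m = true ∨ s ≤ m ∧ J.testBit (m - s) = true) ∧ mask.testBit m = true := by
  have : adjoin s mask J = (J ||| J <<< s) &&& mask := rfl
  simp [this]

theorem lt_64_of_testBit {g m : ℕ} (hg : g < 2 ^ 64) (h : g.testBit m = true) : m < 64 := by
  by_contra hm
  have := Nat.testBit_lt_two_pow (hg.trans_le (Nat.pow_le_pow_right (by norm_num) (not_lt.1 hm)))
  simp [this] at h

theorem exists_of_testBit_adjoin {t : ℕ × ℕ} (ht : t ∈ bitPlanes) {J m : ℕ}
    (h : (adjoin t.1 t.2 J).testBit m = true) : ∃ D, J.testBit D = true ∧ m = D ||| t.1 := by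
  obtain ⟨k, hk, e, hlt, hbit⟩ := bitPlanes_spec t ht
  obtain ⟨hJ, hm⟩ := testBit_adjoin.1 h
  have hm64 := lt_64_of_testBit hlt hm
  rw [hbit m hm64] at hm
  obtain ⟨-, h2, h3⟩ := lor_two_pow_of_testBit k hk m hm64 hm
  rw [e] at hJ ⊢
  rcases hJ with hJ | ⟨-, hJ⟩
  exacts [⟨m, hJ, h3.symm⟩, ⟨_, hJ, h2.symm⟩]

theorem testBit_adjoin_of_testBit {t : ℕ × ℕ} (ht : t ∈ bitPlanes) {J D : ℕ} (hD : D < 64)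
    (h : J.testBit D = true) : (adjoin t.1 t.2 J).testBit (D ||| t.1) = true := by
  obtain ⟨k, hk, e, -, hbit⟩ := bitPlanes_spec t ht
  have hlt : D ||| 2 ^ k < 64 :=
    lor_lt_64 hD (Nat.pow_lt_pow_right (by norm_num) hk : 2 ^ k < 2 ^ 6)
  obtain ⟨h1, h2⟩ := testBit_lor_two_pow k hk D hD
  rw [e, testBit_adjoin, hbit _ hlt]
  refine ⟨?_, h1⟩
  rcases h2 with h2 | ⟨h2, h3⟩
  · rw [h2]
    exact Or.inl h
  · rw [h3]
    exact Or.inr ⟨h2, h⟩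

theorem beq_zero_eq_false {n : ℕ} (hn : n ≠ 0) : Nat.beq n 0 = false := by
  cases n with
  | zero => exact absurd rfl hn
  | succ n => rfl

/-- The mask of the family of all `D ||| A` with `D` in the family with mask `J`. -/
noncomputable def adjoinCode (ts : List (ℕ × ℕ)) (A J : ℕ) : ℕ :=
  @List.rec (ℕ × ℕ) (fun _ => ℕ → ℕ) (fun J => J)
    (fun t _ ih J =>
      @Prod.rec _ _ (fun _ => ℕ) (fun s mask =>
        @Bool.rec (fun _ => ℕ) (ih (adjoin s mask J)) (ih J) (Nat.beq (Nat.land A s) 0)) t)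
    ts J

theorem adjoinCode_cons (t : ℕ × ℕ) (ts : List (ℕ × ℕ)) (A J : ℕ) :
    adjoinCode (t :: ts) A J =
      if Nat.land A t.1 = 0 then adjoinCode ts A J else adjoinCode ts A (adjoin t.1 t.2 J) := by
  change @Bool.rec (fun _ => ℕ) _ _ (Nat.beq (Nat.land A t.1) 0) = _
  split_ifs with h
  · rw [h]
    rfl
  · rw [beq_zero_eq_false h]
    rfl

/-- The code of all bits of a list of bit planes. -/
def bitsOfPlanes (ts : List (ℕ × ℕ)) : ℕ :=
  ts.foldr (fun t s => t.1 ||| s) 0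

theorem land_plane_cases {t : ℕ × ℕ} (ht : t ∈ bitPlanes) (A : ℕ) :
    Nat.land A t.1 = 0 ∨ Nat.land A t.1 = t.1 := by
  obtain ⟨k, -, e, -⟩ := bitPlanes_spec t ht
  change A &&& t.1 = 0 ∨ A &&& t.1 = t.1
  rw [e, Nat.and_two_pow]
  cases A.testBit k <;> simp

/-- The induction on the planes only sees the part of A on the remaining planes; for all six planes
the bits add up to 63 and this part is A. -/
theorem testBit_adjoinCode_aux {ts : List (ℕ × ℕ)} (hts : ∀ t ∈ ts, t ∈ bitPlanes) (A J m : ℕ) :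
    (adjoinCode ts A J).testBit m = true →
      ∃ D, J.testBit D = true ∧ m = D ||| (A &&& bitsOfPlanes ts) := by
  induction ts generalizing J with
  | nil => exact fun h => ⟨m, h, by simp [bitsOfPlanes]⟩
  | cons t ts ih =>
    intro h
    have e : bitsOfPlanes (t :: ts) = t.1 ||| bitsOfPlanes ts := rfl
    rw [e, Nat.and_or_distrib_left]
    have ht := hts t List.mem_cons_self
    have ih := fun J => ih (fun t ht => hts t (List.mem_cons_of_mem _ ht)) J
    rcases land_plane_cases ht A with h0 | h0
    · rw [adjoinCode_cons, if_pos h0] at h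
      obtain ⟨D, hD, rfl⟩ := ih _ h
      refine ⟨D, hD, ?_⟩
      rw [show A &&& t.1 = 0 from h0, Nat.zero_or]
    · obtain ⟨k, -, e', -⟩ := bitPlanes_spec t ht
      -- The place value of a plane is nonzero, so the recursion takes the branch that adjoins the
      -- bit.
      have hne : t.1 ≠ 0 := by
        rw [e']
        positivity
      rw [adjoinCode_cons, h0, if_neg hne] at h
      obtain ⟨D, hD, rfl⟩ := ih _ h
      obtain ⟨D', hD', rfl⟩ := exists_of_testBit_adjoin ht hD
      refine ⟨D', hD', ?_⟩
      rw [show A &&& t.1 = t.1 from h0, Nat.or_assoc]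

theorem exists_of_testBit_adjoinCode {A J m : ℕ} (hA : A < 64)
    (h : (adjoinCode bitPlanes A J).testBit m = true) :
    ∃ D, J.testBit D = true ∧ m = D ||| A := by
  have := testBit_adjoinCode_aux (fun t ht => ht) A J m h
  rwa [show bitsOfPlanes bitPlanes = 2 ^ 6 - 1 by decide, Nat.and_two_pow_sub_one_eq_mod,
    Nat.mod_eq_of_lt hA] at this

theorem testBit_adjoinCode_lor {ts : List (ℕ × ℕ)} (hts : ∀ t ∈ ts, t ∈ bitPlanes) {A J D : ℕ}
    (hD : D < 64) (h : J.testBit D = true) :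
    (adjoinCode ts A J).testBit (D ||| (A &&& bitsOfPlanes ts)) = true := by
  induction ts generalizing J D with
  | nil => simpa [bitsOfPlanes, adjoinCode] using h
  | cons t ts ih =>
    have e : bitsOfPlanes (t :: ts) = t.1 ||| bitsOfPlanes ts := rfl
    have ht := hts t List.mem_cons_self
    obtain ⟨k, hk, e', -⟩ := bitPlanes_spec t ht
    rw [e, Nat.and_or_distrib_left]
    have ih := fun {J D} => @ih (fun t ht => hts t (List.mem_cons_of_mem _ ht)) J D
    rcases land_plane_cases ht A with h0 | h0
    · rw [adjoinCode_cons, if_pos h0, show A &&& t.1 = 0 from h0, Nat.zero_or]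
      exact ih hD h
    · have hne : t.1 ≠ 0 := by
        rw [e']
        positivity
      rw [adjoinCode_cons, h0, if_neg hne, show A &&& t.1 = t.1 from h0, ← Nat.or_assoc]
      refine ih (lor_lt_64 hD ?_) (testBit_adjoin_of_testBit ht hD h)
      rw [e']
      exact (Nat.pow_lt_pow_right (by norm_num) hk : 2 ^ k < 2 ^ 6)

theorem testBit_adjoinCode {A J D : ℕ} (hA : A < 64) (hD : D < 64) (h : J.testBit D = true) :
    (adjoinCode bitPlanes A J).testBit (D ||| A) = true := by
  have := testBit_adjoinCode_lor (A := A) (fun t ht => ht : ∀ t ∈ bitPlanes, _) hD h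
  rwa [show bitsOfPlanes bitPlanes = 2 ^ 6 - 1 by decide, Nat.and_two_pow_sub_one_eq_mod,
    Nat.mod_eq_of_lt hA] at this

/-- The mask of the family which arises from the family with mask `J` by adjoining the codes in
`l` one after the other. -/
noncomputable def closureMask (l : List ℕ) (J : ℕ) : ℕ :=
  foldList (fun A J => Nat.lor J (adjoinCode bitPlanes A J)) J l

/-! ### Greedy flows -/

/-- The digit in base `2 ^ 32` of the table `caps` at the place `B`. -/
def capacity (caps B : ℕ) : ℕ :=
  caps / (2 ^ B) ^ 32 % 4294967296

theorem capacity_eq_mod (caps : ℕ) {B B' : ℕ} (h : B' < B) :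
    capacity caps B' = capacity (caps % (2 ^ B) ^ 32) B' := by
  unfold capacity
  rw [← pow_mul, ← pow_mul, ← Nat.shiftRight_eq_div_pow, ← Nat.shiftRight_eq_div_pow,
    show 4294967296 = 2 ^ 32 by norm_num]
  refine Nat.eq_of_testBit_eq fun i => ?_
  simp only [Nat.testBit_mod_two_pow, Nat.testBit_shiftRight]
  by_cases hi : i < 32
  · have : B' * 32 + i < B * 32 := by omega
    simp [hi, this]
  · simp [hi]

theorem capacity_eq_div (caps : ℕ) {B B' : ℕ} (h : B < B') :
    capacity caps B' = capacity (caps / (2 ^ B) ^ 32 / 4294967296) (B' - B - 1) := by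
  unfold capacity
  rw [Nat.div_div_eq_div_mul, Nat.div_div_eq_div_mul, ← pow_mul, ← pow_mul, ← pow_mul,
    show 4294967296 = 2 ^ 32 by norm_num, ← pow_add, ← pow_add,
    show B * 32 + (32 + (B' - B - 1) * 32) = B' * 32 by omega]

/-- Subtracting a multiple of P that the quotient can afford leaves the remainder alone: there is no
borrow from lower places. -/
theorem sub_mul_digits {n P r q : ℕ} (hP : 0 < P) (h : n / P = r + q) :
    (n - r * P) / P = q ∧ (n - r * P) % P = n % P := by
  have e : n - r * P = P * q + n % P := by
    have := Nat.div_add_mod n P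
    rw [h] at this
    have h2 : P * (r + q) = r * P + P * q := by ring
    omega
  rw [e]
  refine ⟨?_, ?_⟩
  · rw [Nat.mul_add_div hP, Nat.div_eq_of_lt (Nat.mod_lt _ hP), add_zero]
  · rw [Nat.mul_add_mod, Nat.mod_mod]

/-- As r is at most the digit at B, no borrow occurs. Lower digits are read from the unchanged
remainder, higher ones from a quotient that the subtraction does not reach. -/
theorem capacity_sub {caps r B : ℕ} (h : r ≤ capacity caps B) (B' : ℕ) :
    capacity (caps - r * (2 ^ B) ^ 32) B' =
      if B' = B then capacity caps B - r else capacity caps B' := by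
  have hP : 0 < (2 ^ B) ^ 32 := by positivity
  have hr : r ≤ caps / (2 ^ B) ^ 32 := h.trans (Nat.mod_le _ _)
  obtain ⟨h1, h2⟩ := sub_mul_digits (q := caps / (2 ^ B) ^ 32 - r) hP
    (Nat.add_sub_cancel' hr).symm
  have hc : capacity caps B = caps / (2 ^ B) ^ 32 % 4294967296 := rfl
  rcases lt_trichotomy B' B with hlt | rfl | hlt
  · rw [if_neg hlt.ne, capacity_eq_mod _ hlt, h2, ← capacity_eq_mod _ hlt]
  · rw [if_pos rfl, capacity, h1]
    omega
  · rw [if_neg hlt.ne', capacity_eq_div _ hlt, h1, capacity_eq_div caps hlt]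
    congr 1
    omega

/-- Subtracting 1 changes precisely the lowest set bit and the zeros below it, so `y &&& (y - 1)` is
y without its lowest bit. The proof halves y until it is odd. -/
theorem exists_lowest_bit {y : ℕ} (hy : y ≠ 0) :
    ∃ B, y.testBit B = true ∧ y ^^^ (y &&& (y - 1)) = 2 ^ B := by
  have key : ∃ B, y.testBit B = true ∧
      ∀ i, (y ^^^ (y &&& (y - 1))).testBit i = decide (B = i) := by
    induction y using Nat.strong_induction_on with
    | _ y ih =>
      rcases Nat.even_or_odd' y with ⟨q, rfl | rfl⟩
      · obtain ⟨B, hB, h⟩ := ih q (by omega) (by omega)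
        refine ⟨B + 1, ?_, fun i => ?_⟩
        · rwa [Nat.testBit_add_one, Nat.mul_div_cancel_left _ (by norm_num)]
        · cases i with
          | zero => simp
          | succ i =>
            have := h i
            simp only [Nat.testBit_xor, Nat.testBit_and] at this
            rw [Nat.testBit_xor, Nat.testBit_and, Nat.testBit_add_one, Nat.testBit_add_one,
              Nat.mul_div_cancel_left q (show 0 < 2 by norm_num),
              show (2 * q - 1) / 2 = q - 1 by omega, this]
            simp
      · refine ⟨0, by simp, fun i => ?_⟩
        rw [Nat.testBit_xor, Nat.testBit_and]
        cases i with
        | zero => simp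
        | succ i =>
          rw [Nat.testBit_add_one, Nat.testBit_add_one, show (2 * q + 1) / 2 = q by omega,
            show (2 * q + 1 - 1) / 2 = q by omega]
          simp
  obtain ⟨B, hB, h⟩ := key
  refine ⟨B, hB, Nat.eq_of_testBit_eq fun i => ?_⟩
  rw [h, Nat.testBit_two_pow]

/-- The total capacity that is left in `G` at the places in the mask `av`. -/
def room (G : Finset ℕ) (av caps : ℕ) : ℕ :=
  ∑ B ∈ G, if av.testBit B = true then capacity caps B else 0

/-- Striking out a place costs room only if the place belongs to G; the same holds for taking a part
of its capacity in `room_sub`. -/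
theorem room_xor {G : Finset ℕ} {av B : ℕ} (h : av.testBit B = true) (caps : ℕ) :
    room G (av ^^^ 2 ^ B) caps + (if B ∈ G then capacity caps B else 0) = room G av caps := by
  have e : (if B ∈ G then capacity caps B else 0) =
      ∑ A ∈ G, if A = B then capacity caps B else 0 := by
    rw [Finset.sum_ite_eq']
  rw [e, room, room, ← Finset.sum_add_distrib]
  refine Finset.sum_congr rfl fun A _ => ?_
  rw [Nat.testBit_xor, Nat.testBit_two_pow]
  rcases eq_or_ne A B with rfl | hne
  · simp [h]
  · simp [hne, hne.symm]

theorem room_sub {G : Finset ℕ} {av B : ℕ} (h : av.testBit B = true) {caps r : ℕ}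
    (hr : r ≤ capacity caps B) :
    room G av (caps - r * (2 ^ B) ^ 32) + (if B ∈ G then r else 0) = room G av caps := by
  have e : (if B ∈ G then r else 0) = ∑ A ∈ G, if A = B then r else 0 := by
    rw [Finset.sum_ite_eq']
  rw [e, room, room, ← Finset.sum_add_distrib]
  refine Finset.sum_congr rfl fun A _ => ?_
  rw [capacity_sub hr]
  rcases eq_or_ne A B with rfl | hne
  · simp [h, hr]
  · simp [hne]

/-- Takes `r` units from the capacities at the places in the mask `y`, the lowest place first, and
continues with the new mask of available places, the new capacities, and `u` increased by the
units which could not be taken. It is written with the recursors because the kernel evaluates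
these fastest. -/
noncomputable def distribute (fuel : ℕ) :
    (y r av caps u : ℕ) → (k : ℕ → ℕ → ℕ → Bool) → Bool :=
  @Nat.rec (fun _ => ℕ → ℕ → ℕ → ℕ → ℕ → (ℕ → ℕ → ℕ → Bool) → Bool)
    (fun _ r av caps u k => k av caps (Nat.add u r))
    (fun _ ih y r av caps u k =>
      @Bool.rec (fun _ => Bool)
        ((fun y' =>
          (fun b =>
            (fun i =>
              (fun c =>
                @Bool.rec (fun _ => Bool)
                  (k av (Nat.sub caps (Nat.mul r i)) u)
                  (ih y' (Nat.sub r c) (Nat.xor av b) caps u k)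
                  (Nat.ble c r))
              (Nat.mod (Nat.div caps i) 4294967296))
            (Nat.pow b 32))
          (Nat.xor y y'))
        (Nat.land y (Nat.sub y 1)))
        (k av caps (Nat.add u r))
        (Nat.beq y 0))
    fuel

/-- The lowest place is only known through the number 2 ^ B. Its 32nd power is the place value of
the digit B of the table, so B itself is never computed. An exhausted place is struck from `av`, and
its digit is left in the table unused. -/
theorem distribute_succ {y B : ℕ} (hy : y ≠ 0) (hB : y ^^^ (y &&& (y - 1)) = 2 ^ B)
    (fuel r av caps u : ℕ) (k : ℕ → ℕ → ℕ → Bool) :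
    distribute (fuel + 1) y r av caps u k =
      if capacity caps B ≤ r then
        distribute fuel (y &&& (y - 1)) (r - capacity caps B) (av ^^^ 2 ^ B) caps u k
      else k av (caps - r * (2 ^ B) ^ 32) u := by
  have e : distribute (fuel + 1) y r av caps u k = @Bool.rec (fun _ => Bool)
      (@Bool.rec (fun _ => Bool)
        (k av (caps - r * (y ^^^ (y &&& (y - 1))) ^ 32) u)
        (distribute fuel (y &&& (y - 1))
          (r - caps / (y ^^^ (y &&& (y - 1))) ^ 32 % 4294967296)
          (av ^^^ (y ^^^ (y &&& (y - 1)))) caps u k)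
        (Nat.ble (caps / (y ^^^ (y &&& (y - 1))) ^ 32 % 4294967296) r))
      (k av caps (u + r)) (Nat.beq y 0) := rfl
  rw [e, beq_zero_eq_false hy, hB]
  change @Bool.rec (fun _ => Bool) _ _ (Nat.ble (capacity caps B) r) = _
  split_ifs with h
  · rw [Nat.ble_eq_true_of_le h]
    rfl
  · rw [Bool.eq_false_iff.2 fun h' => h (Nat.le_of_ble_eq_true h')]

/-- The first inequality says that room is never created and debt never lost. By the second, if all
receivers lie in G, the r units are accounted for completely by lost room of G or by new debt in u.
Running out of fuel is harmless, as the rest becomes debt. -/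
theorem distribute_sound (G : Finset ℕ) {fuel y r av caps u : ℕ} {k : ℕ → ℕ → ℕ → Bool}
    (hy : ∀ m, y.testBit m = true → av.testBit m = true)
    (h : distribute fuel y r av caps u k = true) :
    ∃ av' caps' u', k av' caps' u' = true ∧ u + room G av' caps' ≤ u' + room G av caps ∧
      ((∀ m, y.testBit m = true → m ∈ G) → r + u + room G av' caps' ≤ u' + room G av caps) := by
  induction fuel generalizing y r av with
  | zero => exact ⟨av, caps, u + r, h, by omega, fun _ => by omega⟩
  | succ fuel ih =>
    rcases eq_or_ne y 0 with rfl | hy0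
    · exact ⟨av, caps, u + r, h, by omega, fun _ => by omega⟩
    · obtain ⟨B, hyB, hB⟩ := exists_lowest_bit hy0
      rw [distribute_succ hy0 hB] at h
      have hav := hy B hyB
      split_ifs at h with hc
      · have hsub : ∀ m, (y &&& (y - 1)).testBit m = true → y.testBit m = true := by
          intro m hm
          rw [Nat.testBit_and, Bool.and_eq_true] at hm
          exact hm.1
        -- The struck place no longer occurs among the receivers, so the remaining receivers are
        -- still available.
        have hnot : (y &&& (y - 1)).testBit B = false := by
          have := congrArg (Nat.testBit · B) hB
          simpa [Nat.testBit_xor, hyB] using this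
        have hroom := room_xor (G := G) hav caps
        obtain ⟨av', caps', u', hk, h1, h2⟩ := ih (fun m hm => by
          have hne : m ≠ B := by
            rintro rfl
            simp [hnot] at hm
          rw [Nat.testBit_xor, Nat.testBit_two_pow, hy m (hsub m hm)]
          simp [hne.symm]) h
        refine ⟨av', caps', u', hk, by omega, fun hG => ?_⟩
        have h2 := h2 fun m hm => hG m (hsub m hm)
        rw [if_pos (hG B hyB)] at hroom
        omega
      · have hroom := room_sub (G := G) hav (not_le.1 hc).le
        refine ⟨av, _, u, h, by omega, fun hG => ?_⟩
        rw [if_pos (hG B hyB)] at hroom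
        omega

/-! ### Verified branch and bound -/

/-- A bit plane together with twice the weight of its element. -/
abbrev WeightedPlane : Type := (ℕ × ℕ) × ℕ

/-- The bit planes with twice the weights of the elements. -/
def weightedPlanes (w : ℕ → ℕ) : List WeightedPlane :=
  [((32, 18446744069414584320), Nat.mul 2 (w 5)), ((16, 18446462603027742720), Nat.mul 2 (w 4)),
    ((8, 18374966859414961920), Nat.mul 2 (w 3)), ((4, 17361641481138401520), Nat.mul 2 (w 2)),
    ((2, 14757395258967641292), Nat.mul 2 (w 1)), ((1, 12297829382473034410), Nat.mul 2 (w 0))]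

theorem fst_mem_bitPlanes (w : ℕ → ℕ) : ∀ t ∈ weightedPlanes w, t.1 ∈ bitPlanes := by
  simp [weightedPlanes, bitPlanes]

/-- The codes which arise from `A` by adding bits of the given planes, with twice their weights. -/
def weightedCodes : List WeightedPlane → ℕ → ℕ → List (ℕ × ℕ)
  | [], A, w2 => [(A, w2)]
  | t :: ts, A, w2 =>
    weightedCodes ts A w2 ++ weightedCodes ts (Nat.lor A t.1.1) (Nat.add w2 t.2)

/-- `s + 2 * w a` if `a` belongs to the set coded by `A`, and `s` otherwise. -/
def addWeight (w : ℕ → ℕ) (A a s : ℕ) : ℕ :=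
  bif A.testBit a then Nat.add s (Nat.mul 2 (w a)) else s

theorem addWeight_eq (w : ℕ → ℕ) (A a s : ℕ) :
    addWeight w A a s = s + 2 * if A.testBit a = true then w a else 0 := by
  unfold addWeight
  cases A.testBit a <;> simp

/-- The planes descend from the highest bit and the branch without the bit precedes the one with it,
so the codes appear in increasing order. -/
theorem weightedCodes_weightedPlanes (w : ℕ → ℕ) : weightedCodes (weightedPlanes w) 0 0 =
    (List.range 64).map fun A => (A, 2 * codeWeight w A) := by
  -- The weights are nested in the order in which the traversal adds them, bit 5 innermost, so that
  -- both lists agree by computation.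
  have h1 : weightedCodes (weightedPlanes w) 0 0 = (List.range 64).map fun A =>
      (A, addWeight w A 0 (addWeight w A 1 (addWeight w A 2
        (addWeight w A 3 (addWeight w A 4 (addWeight w A 5 0)))))) := by
    simp only [weightedCodes, weightedPlanes, List.cons_append, List.nil_append]
    rfl
  rw [h1]
  refine List.map_congr_left fun A _ => ?_
  have h2 : codeWeight w A = ∑ a ∈ Finset.range 6, if A.testBit a = true then w a else 0 := by
    rw [codeWeight, setOfCode, Finset.sum_filter]
  rw [h2]
  simp only [addWeight_eq, Finset.sum_range_succ, Finset.sum_range_zero]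
  congr 1
  ring

/-- Visits the codes which arise from `A` by adding bits of the planes in `l`. Here `y` is the mask
of the family of all `D ||| A` with `D` in a fixed family, and `w2` is twice the weight of `A`.
For `A` in the family with mask `In`, the total weight `W` is added to `u` and `w2` to `p`. For any
other `A` such that `y` and `Out` have no common member, the deficit of `w2` compared with `W` is
distributed over the available capacities in `y`. -/
noncomputable def visit (In Out W : ℕ) (l : List WeightedPlane) :
    (A w2 y : ℕ) → (k : ℕ → ℕ → ℕ → ℕ → Bool) → (av caps u p : ℕ) → Bool :=
  @List.rec WeightedPlane
    (fun _ => ℕ → ℕ → ℕ → (ℕ → ℕ → ℕ → ℕ → Bool) → ℕ → ℕ → ℕ → ℕ → Bool)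
    (fun A w2 y k av caps u p =>
      @Bool.rec (fun _ => Bool) (k av caps u p)
        (@Bool.rec (fun _ => Bool) (k av caps (Nat.add u W) (Nat.add p w2))
          (@Bool.rec (fun _ => Bool)
            (distribute 64 (Nat.land y av) (Nat.sub W w2) av caps u
              (fun av caps u => k av caps u p))
            (k av caps u p) (Nat.ble W w2))
          (Nat.beq (Nat.land 1 (Nat.shiftRight In A)) 0))
        (Nat.beq (Nat.land y Out) 0))
    (fun t _ ih A w2 y k av caps u p =>
      @Prod.rec _ _ (fun _ => Bool) (fun pl w =>
        @Prod.rec _ _ (fun _ => Bool) (fun s mask =>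
          ih A w2 y (ih (Nat.lor A s) (Nat.add w2 w) (adjoin s mask y) k) av caps u p) pl) t)
    l

theorem visit_cons (In Out W : ℕ) (t : WeightedPlane) (l : List WeightedPlane) (A w2 y : ℕ)
    (k : ℕ → ℕ → ℕ → ℕ → Bool) (av caps u p : ℕ) :
    visit In Out W (t :: l) A w2 y k av caps u p =
      visit In Out W l A w2 y (visit In Out W l (A ||| t.1.1) (w2 + t.2) (adjoin t.1.1 t.1.2 y) k)
        av caps u p :=
  rfl

theorem visit_nil (In Out W : ℕ) (A w2 y : ℕ) (k : ℕ → ℕ → ℕ → ℕ → Bool) (av caps u p : ℕ) :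
    visit In Out W [] A w2 y k av caps u p =
      if y &&& Out = 0 then
        if In.testBit A = true then k av caps (u + W) (p + w2)
        else if W ≤ w2 then k av caps u p
        else distribute 64 (y &&& av) (W - w2) av caps u fun av caps u => k av caps u p
      else k av caps u p := by
  change @Bool.rec (fun _ => Bool) _ (@Bool.rec (fun _ => Bool) _ (@Bool.rec (fun _ => Bool) _ _ _)
    (Nat.beq (1 &&& (In >>> A)) 0)) (Nat.beq (y &&& Out) 0) = _
  split_ifs with h1 h2 h3
  · rw [h1, beq_zero_eq_false (by simpa [Nat.testBit] using h2)]
    rfl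
  · rw [h1, show 1 &&& (In >>> A) = 0 by simpa [Nat.testBit] using h2, Nat.ble_eq_true_of_le h3]
    rfl
  · rw [h1, show 1 &&& (In >>> A) = 0 by simpa [Nat.testBit] using h2,
      Bool.eq_false_iff.2 fun h' => h3 (Nat.le_of_ble_eq_true h')]
    rfl
  · rw [beq_zero_eq_false h1]

/-- A node of the search: the family `G` has all members of the mask `In` and no member of the mask
`Out`, and it absorbs all members of the mask `J`. -/
structure Compatible (G : Finset ℕ) (In J Out : ℕ) : Prop where
  mem : ∀ A, In.testBit A = true → A ∈ G
  absorbs : ∀ D, J.testBit D = true → ∀ A ∈ G, D ||| A ∈ G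
  notMem : ∀ A, Out.testBit A = true → A ∉ G

/-- What the member `t.1` of `G`, of weight `t.2 / 2`, lacks in weight. -/
def need (G : Finset ℕ) (In W : ℕ) (t : ℕ × ℕ) : ℕ :=
  if t.1 ∈ G then if In.testBit t.1 = true then W else W - t.2 else 0

/-- The weight of the codes in the family with mask `In`. -/
def gain (In : ℕ) (t : ℕ × ℕ) : ℕ :=
  if In.testBit t.1 = true then t.2 else 0

/-- If A belongs to G, then so does every member of y, because G absorbs J. Hence a common member of
y and Out rules A out, and otherwise the deficit of A is paid from room within G or becomes debt.
For A outside G nothing is needed, and a needless payment is harmless because room never grows. The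
bound on p is only an inequality because a code that is ruled out adds nothing to p. -/
theorem visit_sound {G : Finset ℕ} {In J Out : ℕ} (hG : Compatible G In J Out) (W : ℕ)
    {l : List WeightedPlane} (hl : ∀ t ∈ l, t.1 ∈ bitPlanes) {A w2 y av caps u p : ℕ}
    {k : ℕ → ℕ → ℕ → ℕ → Bool}
    (hy : ∀ m, y.testBit m = true → ∃ D, J.testBit D = true ∧ m = D ||| A)
    (h : visit In Out W l A w2 y k av caps u p = true) :
    ∃ av' caps' u' p', k av' caps' u' p' = true ∧
      ((weightedCodes l A w2).map (need G In W)).sum + u + room G av' caps' ≤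
        u' + room G av caps ∧
      p' ≤ p + ((weightedCodes l A w2).map (gain In)).sum := by
  induction l generalizing A w2 y av caps u p k with
  | nil =>
    simp only [weightedCodes, List.map_cons, List.map_nil, List.sum_cons, List.sum_nil, add_zero,
      need, gain]
    have hyG : A ∈ G → ∀ m, y.testBit m = true → m ∈ G := by
      intro hA m hm
      obtain ⟨D, hD, rfl⟩ := hy m hm
      exact hG.absorbs D hD A hA
    rw [visit_nil] at h
    split_ifs at h with h1 h2 h3
    · refine ⟨_, _, _, _, h, ?_, ?_⟩
      · split_ifs <;> omega
      · rw [if_pos h2]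
    · refine ⟨_, _, _, _, h, ?_, ?_⟩
      · split_ifs <;> omega
      · rw [if_neg h2]
        omega
    · obtain ⟨av', caps', u', hk, e1, e2⟩ := distribute_sound G (fun m hm => by
        rw [Nat.testBit_and, Bool.and_eq_true] at hm
        exact hm.2) h
      refine ⟨_, _, _, _, hk, ?_, by omega⟩
      split_ifs with hA
      · exact e2 fun m hm => hyG hA m (by
          rw [Nat.testBit_and, Bool.and_eq_true] at hm
          exact hm.1)
      · omega
    · obtain ⟨m, hm⟩ := Nat.exists_testBit_of_ne_zero h1
      rw [Nat.testBit_and, Bool.and_eq_true] at hm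
      have hA : A ∉ G := fun hA => hG.notMem m hm.2 (hyG hA m hm.1)
      refine ⟨_, _, _, _, h, ?_, by omega⟩
      rw [if_neg hA]
      omega
  | cons t l ih =>
    have ht := hl t List.mem_cons_self
    have hl' : ∀ t ∈ l, t.1 ∈ bitPlanes := fun t ht => hl t (List.mem_cons_of_mem _ ht)
    rw [visit_cons] at h
    obtain ⟨av1, caps1, u1, p1, h1, e1, e1'⟩ := ih hl' hy h
    obtain ⟨av2, caps2, u2, p2, h2, e2, e2'⟩ := ih hl' (fun m hm => by
      obtain ⟨D, hD, rfl⟩ := exists_of_testBit_adjoin ht hm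
      obtain ⟨D', hD', rfl⟩ := hy D hD
      exact ⟨D', hD', Nat.or_assoc _ _ _⟩) h1
    have e : weightedCodes (t :: l) A w2 =
      weightedCodes l A w2 ++ weightedCodes l (A ||| t.1.1) (w2 + t.2) := rfl
    refine ⟨_, _, _, _, h2, ?_, ?_⟩
    · rw [e, List.map_append, List.sum_append]
      omega
    · rw [e, List.map_append, List.sum_append]
      omega

/-- If the visit of all codes succeeds, then the average weight in `G` is at least `W / 2`. -/
theorem le_sum_of_visit {G : Finset ℕ} {In J Out : ℕ} (hG : Compatible G In J Out)
    (hlt : ∀ A ∈ G, A < 64) (w : ℕ → ℕ) {W av caps : ℕ}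
    (hav : ∀ A, av.testBit A = true → In.testBit A = false)
    (hcaps : ∀ A < 64, capacity caps A ≤ 2 * codeWeight w A - W)
    (h : visit In Out W (weightedPlanes w) 0 0 J (fun _ _ u p => Nat.ble u p) av caps 0 0 =
      true) :
    W * G.card ≤ ∑ A ∈ G, 2 * codeWeight w A := by
  obtain ⟨av', caps', u', p', hk, h1, h2⟩ := visit_sound hG W (fst_mem_bitPlanes w)
    (fun m hm => ⟨m, hm, (Nat.or_zero m).symm⟩) h
  have hup := Nat.le_of_ble_eq_true hk
  have hsub : G ⊆ Finset.range 64 := fun A hA => Finset.mem_range.2 (hlt A hA)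
  -- Needs and gains vanish outside G, as In is part of G, so sums over all 64 codes are sums over
  -- G.
  have hsum : ∀ f : ℕ × ℕ → ℕ, (∀ A, A ∉ G → f (A, 2 * codeWeight w A) = 0) →
      ((weightedCodes (weightedPlanes w) 0 0).map f).sum =
        ∑ A ∈ G, f (A, 2 * codeWeight w A) := by
    intro f hf
    rw [weightedCodes_weightedPlanes, List.map_map]
    exact (Finset.sum_subset hsub fun A _ hA => hf A hA).symm
  rw [hsum _ fun A hA => by simp [need, hA]] at h1
  rw [hsum _ fun A hA => by
    have : ¬ In.testBit A = true := fun h => hA (hG.mem A h)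
    simp [gain, this]] at h2
  -- This holds for each member: equality for A in In, where no capacity is available; otherwise the
  -- deficit raises a light set to W, and a heavy set exceeds W by at least its capacity. With needs
  -- bounded by gains plus room, the extra terms cancel.
  have key : ∑ A ∈ G, (W + (gain In (A, 2 * codeWeight w A) +
        if av.testBit A = true then capacity caps A else 0)) ≤
      ∑ A ∈ G, (2 * codeWeight w A + need G In W (A, 2 * codeWeight w A)) := by
    refine Finset.sum_le_sum fun A hA => ?_
    have hc := hcaps A (hlt A hA)
    have ha := hav A
    simp only [gain, need, if_pos hA]
    split_ifs with h3 h4 h4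
    · simp [ha h4] at h3
    all_goals omega
  rw [Finset.sum_add_distrib, Finset.sum_add_distrib, Finset.sum_add_distrib, Finset.sum_const,
    smul_eq_mul, mul_comm] at key
  change _ + (_ + room G av caps) ≤ _ at key
  omega

/-! ### The search tree: branching on membership and closing nodes. -/

/-- The list `weightedCodes l A w2 ++ acc`. -/
noncomputable def weightedCodesAppend (l : List WeightedPlane) :
    ℕ → ℕ → List (ℕ × ℕ) → List (ℕ × ℕ) :=
  @List.rec WeightedPlane (fun _ => ℕ → ℕ → List (ℕ × ℕ) → List (ℕ × ℕ))
    (fun A w2 acc => (A, w2) :: acc)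
    (fun t _ ih A w2 acc => ih A w2 (ih (Nat.lor A t.1.1) (Nat.add w2 t.2) acc)) l

theorem weightedCodesAppend_eq (l : List WeightedPlane) (A w2 : ℕ) (acc : List (ℕ × ℕ)) :
    weightedCodesAppend l A w2 acc = weightedCodes l A w2 ++ acc := by
  induction l generalizing A w2 acc with
  | nil => rfl
  | cons t l ih =>
    change weightedCodesAppend l A w2
      (weightedCodesAppend l (Nat.lor A t.1.1) (Nat.add w2 t.2) acc) = _
    rw [ih, ih, weightedCodes, List.append_assoc]

/-- Runs the search given by the digits of `code` in base `65`, from the lowest digit on, for the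
stack `st` of open nodes: the digit `64` closes the first node by a visit of all codes, any other
digit branches on whether this code belongs to the family. -/
noncomputable def runSearch (ps : List WeightedPlane) (W av caps n : ℕ) :
    ℕ → List (ℕ × ℕ × ℕ) → Bool :=
  @Nat.rec (fun _ => ℕ → List (ℕ × ℕ × ℕ) → Bool)
    (fun _ st => @List.rec _ (fun _ => Bool) true (fun _ _ _ => false) st)
    (fun _ ih code st =>
      @List.rec _ (fun _ => Bool) true
        (fun s st _ =>
          @Prod.rec _ _ (fun _ => Bool) (fun In s =>
            @Prod.rec _ _ (fun _ => Bool) (fun J Out =>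
              (fun t =>
                @Bool.rec (fun _ => Bool)
                  ((fun y =>
                    ih (Nat.div code 65) ((Nat.lor In y, Nat.lor J y, Out) ::
                      (In, J, Nat.lor Out (Nat.shiftLeft 1 t)) :: st))
                  (adjoinCode bitPlanes t J))
                  (@Bool.rec (fun _ => Bool) false (ih (Nat.div code 65) st)
                    (visit In Out W ps 0 0 J (fun _ _ u p => Nat.ble u p)
                      (Nat.xor av (Nat.land av In)) caps 0 0))
                  (Nat.ble 64 t))
              (Nat.mod code 65)) s) s) st)
    n

theorem runSearch_zero_cons (ps : List WeightedPlane) (W av caps code : ℕ) (s : ℕ × ℕ × ℕ)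
    (st : List (ℕ × ℕ × ℕ)) : runSearch ps W av caps 0 code (s :: st) = false :=
  rfl

theorem runSearch_succ_cons (ps : List WeightedPlane) (W av caps n code In J Out : ℕ)
    (st : List (ℕ × ℕ × ℕ)) :
    runSearch ps W av caps (n + 1) code ((In, J, Out) :: st) =
      if 64 ≤ code % 65 then
        visit In Out W ps 0 0 J (fun _ _ u p => Nat.ble u p) (av ^^^ (av &&& In)) caps 0 0 &&
          runSearch ps W av caps n (code / 65) st
      else
        runSearch ps W av caps n (code / 65)
          ((In ||| adjoinCode bitPlanes (code % 65) J,
            J ||| adjoinCode bitPlanes (code % 65) J, Out) ::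
          (In, J, Out ||| 1 <<< (code % 65)) :: st) := by
  change @Bool.rec (fun _ => Bool) _ (@Bool.rec (fun _ => Bool) false _
    (visit In Out W ps 0 0 J (fun _ _ u p => Nat.ble u p) (av ^^^ (av &&& In)) caps 0 0))
    (Nat.ble 64 (code % 65)) = _
  split_ifs with h
  · rw [Nat.ble_eq_true_of_le h]
    cases visit In Out W ps 0 0 J (fun _ _ u p => Nat.ble u p) (av ^^^ (av &&& In)) caps 0 0 <;>
      rfl
  · rw [Bool.eq_false_iff.2 fun h' => h (Nat.le_of_ble_eq_true h')]
    rfl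

theorem Compatible.absorbs_adjoinCode {G : Finset ℕ} {In J Out : ℕ} (hG : Compatible G In J Out)
    {t m : ℕ} (ht : t < 64) (hm : (adjoinCode bitPlanes t J).testBit m = true)
    (habs : ∀ A ∈ G, t ||| A ∈ G) : ∀ A ∈ G, m ||| A ∈ G := by
  obtain ⟨D, hD, rfl⟩ := exists_of_testBit_adjoinCode ht hm
  intro A hA
  rw [Nat.or_assoc]
  exact hG.absorbs D hD _ (habs A hA)

/-- Once t belongs to G, each D ∪ t with D in J belongs to G by absorption. It is also absorbed,
since G absorbs D and, being union-closed, absorbs t. -/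
theorem Compatible.of_mem {G : Finset ℕ} {In J Out : ℕ} (hG : Compatible G In J Out)
    (hclosed : UnionClosedCodes G) {t : ℕ} (ht : t ∈ G) :
    Compatible G (In ||| adjoinCode bitPlanes t J) (J ||| adjoinCode bitPlanes t J) Out where
  mem m hm := by
    rw [Nat.testBit_or, Bool.or_eq_true] at hm
    rcases hm with hm | hm
    · exact hG.mem m hm
    · obtain ⟨D, hD, rfl⟩ := exists_of_testBit_adjoinCode (hclosed.lt t ht) hm
      exact hG.absorbs D hD t ht
  absorbs m hm := by
    rw [Nat.testBit_or, Bool.or_eq_true] at hm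
    rcases hm with hm | hm
    · exact hG.absorbs m hm
    · exact hG.absorbs_adjoinCode (hclosed.lt t ht) hm (hclosed.lor_mem t ht)
  notMem := hG.notMem

theorem Compatible.of_notMem {G : Finset ℕ} {In J Out : ℕ} (hG : Compatible G In J Out) {t : ℕ}
    (ht : t ∉ G) : Compatible G In J (Out ||| 1 <<< t) where
  mem := hG.mem
  absorbs := hG.absorbs
  notMem m hm := by
    rw [Nat.testBit_or, Bool.or_eq_true, Nat.one_shiftLeft, Nat.testBit_two_pow] at hm
    rcases hm with hm | hm
    · exact hG.notMem m hm
    · rwa [← of_decide_eq_true hm]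

/-- A successful run closes every node of the stack. Any `code` is admissible: a poor choice of
branchings can make the run fail, but cannot make it wrong. -/
theorem runSearch_sound {G : Finset ℕ} (hclosed : UnionClosedCodes G) (w : ℕ → ℕ) {W av caps : ℕ}
    (hcaps : ∀ A < 64, capacity caps A ≤ 2 * codeWeight w A - W) {n code : ℕ}
    {st : List (ℕ × ℕ × ℕ)}
    (h : runSearch (weightedPlanes w) W av caps n code st = true) :
    ∀ s ∈ st, Compatible G s.1 s.2.1 s.2.2 → W * G.card ≤ ∑ A ∈ G, 2 * codeWeight w A := by
  induction n generalizing code st with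
  | zero =>
    cases st with
    | nil => simp
    | cons s st =>
      rw [runSearch_zero_cons] at h
      simp at h
  | succ n ih =>
    cases st with
    | nil => simp
    | cons s st =>
      obtain ⟨In, J, Out⟩ := s
      rw [runSearch_succ_cons] at h
      intro s hs hG
      split_ifs at h
      · rw [Bool.and_eq_true] at h
        rcases List.mem_cons.1 hs with rfl | hs
        -- The available places are `av` without In: prescribed members count with their full weight
        -- in p, so their capacity must not be used as well.
        · refine le_sum_of_visit hG hclosed.lt w (fun A hA => ?_) hcaps h.1
          rw [Nat.testBit_xor, Nat.testBit_and] at hA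
          revert hA
          cases av.testBit A <;> cases In.testBit A <;> simp
        · exact ih h.2 s hs hG
      · have ih := ih h
        rcases List.mem_cons.1 hs with rfl | hs
        -- The family G is compatible with one of the two children, whichever code is branched on.
        · by_cases ht : code % 65 ∈ G
          · exact ih _ List.mem_cons_self (hG.of_mem hclosed ht)
          · exact ih _ (List.mem_cons_of_mem _ List.mem_cons_self) (hG.of_notMem ht)
        · exact ih s (List.mem_cons_of_mem _ (List.mem_cons_of_mem _ hs)) hG

/-- Absorbing D and A implies absorbing D ∪ A. With In and Out empty, compatibility is nothing but
absorption of J. -/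
theorem compatible_closureMask {G : Finset ℕ} {l : List ℕ} (hl : ∀ D ∈ l, D < 64)
    (habs : ∀ D ∈ l, ∀ A ∈ G, A ||| D ∈ G) {J : ℕ} (hG : Compatible G 0 J 0) :
    Compatible G 0 (closureMask l J) 0 := by
  induction l generalizing J with
  | nil => exact hG
  | cons A l ih =>
    have hG := ih (fun D hD => hl D (List.mem_cons_of_mem _ hD))
      (fun D hD => habs D (List.mem_cons_of_mem _ hD)) hG
    refine ⟨hG.mem, fun m hm => ?_, hG.notMem⟩
    have hm' : (closureMask l J ||| adjoinCode bitPlanes A (closureMask l J)).testBit m = true := hm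
    rw [Nat.testBit_or, Bool.or_eq_true] at hm'
    rcases hm' with hm' | hm'
    · exact hG.absorbs m hm'
    · refine hG.absorbs_adjoinCode (hl A List.mem_cons_self) hm' fun B hB => ?_
      rw [Nat.or_comm]
      exact habs A List.mem_cons_self B hB

theorem compatible_closureMask_one {G : Finset ℕ} {l : List ℕ} (hl : ∀ D ∈ l, D < 64)
    (habs : ∀ D ∈ l, ∀ A ∈ G, A ||| D ∈ G) : Compatible G 0 (closureMask l 1) 0 := by
  refine compatible_closureMask hl habs ⟨by simp, fun D hD A hA => ?_, by simp⟩
  -- The start value 1 is the mask of the family {∅}, which every family absorbs.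
  rw [← Nat.pow_zero 2, Nat.testBit_two_pow, decide_eq_true_eq] at hD
  rwa [← hD, Nat.zero_or]

/-- The sum of the weights of the six elements. -/
def totalWeight (w : ℕ → ℕ) : ℕ :=
  Nat.add (w 0) (Nat.add (w 1) (Nat.add (w 2) (Nat.add (w 3) (Nat.add (w 4) (w 5)))))

theorem totalWeight_eq (w : ℕ → ℕ) : totalWeight w = ∑ a ∈ Finset.range 6, w a := by
  simp only [totalWeight, Finset.sum_range_succ, Finset.sum_range_zero, Nat.add_eq]
  ring

/-- The list of all codes with twice their weights. -/
noncomputable def allWeightedCodes (w : ℕ → ℕ) : List (ℕ × ℕ) :=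
  weightedCodesAppend (weightedPlanes w) 0 0 []

theorem allWeightedCodes_eq (w : ℕ → ℕ) :
    allWeightedCodes w = (List.range 64).map fun A => (A, 2 * codeWeight w A) := by
  rw [allWeightedCodes, weightedCodesAppend_eq, List.append_nil, weightedCodes_weightedPlanes]

/-- The mask of the codes whose weight exceeds half of the total weight. -/
noncomputable def heavyMask (w : ℕ → ℕ) : ℕ :=
  foldList (fun t s => @Bool.rec (fun _ => ℕ) (Nat.lor s (Nat.pow 2 t.1)) s
    (Nat.ble t.2 (totalWeight w))) 0 (allWeightedCodes w)

/-- The table of the capacities of the codes. -/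
noncomputable def capacityTable (w : ℕ → ℕ) : ℕ :=
  foldList (fun t s => Nat.add s
    (Nat.mul (Nat.sub t.2 (totalWeight w)) (Nat.pow (Nat.pow 2 t.1) 32))) 0 (allWeightedCodes w)

/-- Checks with the search given by `code` that the weights `w` prove that the family of the codes
in `l` is an FC-family. -/
noncomputable def checkFC (l : List ℕ) (w : ℕ → ℕ) (code : ℕ) : Bool :=
  l.all (fun D => Nat.ble D 63) &&
  ((List.range 6).all fun a => Nat.beq (w a) 0 || l.any fun D => D.testBit a) &&
  ((List.range 6).any fun a => Nat.ble 1 (w a)) &&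
  (allList (allWeightedCodes w) fun t =>
    Nat.ble (Nat.mod (Nat.div (capacityTable w) (Nat.pow (Nat.pow 2 t.1) 32)) 4294967296)
      (Nat.sub t.2 (totalWeight w))) &&
  runSearch (weightedPlanes w) (totalWeight w) (heavyMask w) (capacityTable w) 1000 code
    [(0, closureMask l 1, 0)]

theorem mem_biUnion_familyOfCodes {l : List ℕ} {a : ℕ} :
    a ∈ (familyOfCodes l).biUnion id ↔ a < 6 ∧ ∃ D ∈ l, D.testBit a = true := by
  simp only [Finset.mem_biUnion, mem_familyOfCodes, id]
  constructor
  · rintro ⟨_, ⟨D, hD, rfl⟩, ha⟩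
    rw [mem_setOfCode] at ha
    exact ⟨ha.1, D, hD, ha.2⟩
  · rintro ⟨ha, D, hD, h⟩
    exact ⟨_, ⟨D, hD, rfl⟩, mem_setOfCode.2 ⟨ha, h⟩⟩

theorem isFC_of_checkFC {l : List ℕ} {w : ℕ → ℕ} {code : ℕ} (h : checkFC l w code = true) :
    IsFC (familyOfCodes l) := by
  simp only [checkFC, Bool.and_eq_true] at h
  obtain ⟨⟨⟨⟨h1, h2⟩, h3⟩, h4⟩, h5⟩ := h
  have hl : ∀ D ∈ l, D < 64 := fun D hD =>
    Nat.lt_succ_of_le (Nat.le_of_ble_eq_true (List.all_eq_true.1 h1 D hD))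
  refine isFC_of_weights hl w (fun a ha hw => ?_) ?_ fun G hG habs => ?_
  · have := List.all_eq_true.1 h2 a (List.mem_range.2 ha)
    rw [Bool.or_eq_true] at this
    rcases this with h0 | h0
    · exact absurd (Nat.eq_of_beq_eq_true h0) hw.ne'
    · exact mem_biUnion_familyOfCodes.2 ⟨ha, List.any_eq_true.1 h0⟩
  · obtain ⟨a, ha, hw⟩ := List.any_eq_true.1 h3
    exact ⟨a, List.mem_range.1 ha, Nat.le_of_ble_eq_true hw⟩
  · rw [← totalWeight_eq]
    -- Only an upper bound on the digits of the table is needed; it excludes an overflow into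
    -- neighbouring digits. Nothing has to be known about the mask of heavy codes, since light codes
    -- have capacity 0.
    refine runSearch_sound hG w (fun A hA => ?_) h5 _ List.mem_cons_self ?_
    · refine Nat.le_of_ble_eq_true (allList_eq_true.1 h4 (A, 2 * codeWeight w A) ?_)
      rw [allWeightedCodes_eq]
      exact List.mem_map.2 ⟨A, List.mem_range.2 hA, rfl⟩
    · exact compatible_closureMask_one hl habs

/-! ### Counting with masks -/

/-- The number of the bits of `g` below the place `n`. -/
noncomputable def bitCount (n g : ℕ) : ℕ :=
  @Nat.rec (fun _ => ℕ) 0 (fun n s => Nat.add s (Nat.land 1 (Nat.shiftRight g n))) n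

theorem bitCount_succ (n g : ℕ) :
    bitCount (n + 1) g = Nat.add (bitCount n g) (Nat.land 1 (Nat.shiftRight g n)) :=
  rfl

theorem bitCount_eq_card (n g : ℕ) :
    bitCount n g = ((Finset.range n).filter fun m => g.testBit m = true).card := by
  induction n with
  | zero => rfl
  | succ n ih =>
    rw [Finset.range_add_one, Finset.filter_insert, bitCount_succ, ih]
    have h : Nat.land 1 (Nat.shiftRight g n) = if g.testBit n = true then 1 else 0 := by
      change 1 &&& (g >>> n) = _
      rw [Nat.one_and_eq_mod_two, Nat.testBit_eq_decide_div_mod_eq, Nat.shiftRight_eq_div_pow]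
      rcases Nat.mod_two_eq_zero_or_one (g / 2 ^ n) with h | h <;> simp [h]
    rw [h]
    split_ifs with hb
    · rw [Finset.card_insert_of_notMem (by simp)]
    · rfl

theorem card_codesOfMask (g : ℕ) : (codesOfMask g).card = bitCount 64 g :=
  (bitCount_eq_card 64 g).symm

theorem card_codesContaining_codesOfMask {a mask : ℕ}
    (h : ∀ m < 64, mask.testBit m = m.testBit a) (g : ℕ) :
    (codesContaining a (codesOfMask g)).card = bitCount 64 (Nat.land g mask) := by
  rw [bitCount_eq_card, codesContaining, codesOfMask, Finset.filter_filter]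
  congr 1
  refine Finset.filter_congr fun m hm => ?_
  change _ ↔ (g &&& mask).testBit m = true
  rw [Nat.testBit_and, h m (Finset.mem_range.1 hm), Bool.and_eq_true]

/-- Checks that the family with mask `g` absorbs the codes in `l`. -/
noncomputable def absorbsCodes (l : List ℕ) (g : ℕ) : Bool :=
  allList l fun D => Nat.beq (Nat.lor (adjoinCode bitPlanes D g) g) g

theorem lor_mem_of_absorbsCodes {l : List ℕ} {g : ℕ} (h : absorbsCodes l g = true)
    (hl : ∀ D ∈ l, D < 64) : ∀ D ∈ l, ∀ A ∈ codesOfMask g, A ||| D ∈ codesOfMask g := by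
  intro D hD A hA
  have hD' := hl D hD
  rw [mem_codesOfMask] at hA ⊢
  refine ⟨lor_lt_64 hA.1 hD', ?_⟩
  have h0 : adjoinCode bitPlanes D g ||| g = g :=
    Nat.eq_of_beq_eq_true (allList_eq_true.1 h D hD)
  rw [← h0, Nat.testBit_or, testBit_adjoinCode hD' hA.1 hA.2, Bool.true_or]

/-- The codes below `n` of the family with mask `g`. -/
noncomputable def codeList (n g : ℕ) : List ℕ :=
  @Nat.rec (fun _ => List ℕ) []
    (fun n l => @Bool.rec (fun _ => List ℕ) (n :: l) l
      (Nat.beq (Nat.land 1 (Nat.shiftRight g n)) 0)) n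

theorem mem_codeList {n g m : ℕ} : m ∈ codeList n g ↔ m < n ∧ g.testBit m = true := by
  induction n with
  | zero => exact ⟨fun h => absurd h List.not_mem_nil, fun h => absurd h.1 (Nat.not_lt_zero m)⟩
  | succ n ih =>
    have key : m ∈ codeList (n + 1) g ↔
        m ∈ (if g.testBit n = true then n :: codeList n g else codeList n g) := by
      change m ∈ (@Bool.rec (fun _ => List ℕ) _ _ (Nat.beq (1 &&& (g >>> n)) 0)) ↔ _
      split_ifs with h
      · rw [beq_zero_eq_false (by simpa [Nat.testBit] using h)]
        rfl
      · rw [show 1 &&& (g >>> n) = 0 by simpa [Nat.testBit] using h]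
        rfl
    rw [key]
    split_ifs with h
    · rw [List.mem_cons, ih, Nat.lt_succ_iff_lt_or_eq]
      constructor
      · rintro (rfl | h')
        exacts [⟨Or.inr rfl, h⟩, ⟨Or.inl h'.1, h'.2⟩]
      · rintro ⟨h1 | rfl, h2⟩
        exacts [Or.inr ⟨h1, h2⟩, Or.inl rfl]
    · rw [ih, Nat.lt_succ_iff_lt_or_eq]
      constructor
      · exact fun h' => ⟨Or.inl h'.1, h'.2⟩
      · rintro ⟨h1 | rfl, h2⟩
        exacts [⟨h1, h2⟩, absurd h2 h]

/-- Checks that the family with mask `g` is union-closed. -/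
noncomputable def isUnionClosedMask (g : ℕ) : Bool :=
  absorbsCodes (codeList 64 g) g

theorem unionClosedCodes_codesOfMask {g : ℕ} (h : isUnionClosedMask g = true) :
    UnionClosedCodes (codesOfMask g) where
  lt A hA := (mem_codesOfMask.1 hA).1
  lor_mem A hA B hB := by
    rw [mem_codesOfMask] at hB
    exact lor_mem_of_absorbsCodes h (fun D hD => (mem_codeList.1 hD).1) B (mem_codeList.2 hB) A hA

/-- The certificate check tests absorption of the listed codes only; this extends it to the unions
that they generate. -/
theorem lor_mem_of_mem_closureMask {l : List ℕ} {G : Finset ℕ} (hl : ∀ D ∈ l, D < 64)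
    (habs : ∀ D ∈ l, ∀ A ∈ G, A ||| D ∈ G) :
    ∀ D ∈ codesOfMask (closureMask l 1), ∀ A ∈ G, A ||| D ∈ G := by
  intro D hD A hA
  rw [Nat.or_comm]
  exact (compatible_closureMask_one hl habs).absorbs D (mem_codesOfMask.1 hD).2 A hA

/-- The weighted sum of a list of pairs of a multiplicity and a mask. -/
def multiSum (f : ℕ → ℕ) : List (ℕ × ℕ) → ℕ
  | [] => 0
  | c :: cs => Nat.add (Nat.mul c.1 (f c.2)) (multiSum f cs)

/-- The families of codes in a list of pairs of a multiplicity and a mask. -/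
def multiFamilies (cs : List (ℕ × ℕ)) : List (Finset ℕ) :=
  cs.flatMap fun c => List.replicate c.1 (codesOfMask c.2)

/-- Repeated layers are never written out in the computation: a multiplicity enters just as a
factor. -/
theorem sum_map_multiFamilies {f : Finset ℕ → ℕ} {g : ℕ → ℕ} (h : ∀ m, f (codesOfMask m) = g m)
    (cs : List (ℕ × ℕ)) : ((multiFamilies cs).map f).sum = multiSum g cs := by
  induction cs with
  | nil => rfl
  | cons c cs ih =>
    have e : multiFamilies (c :: cs) =
      List.replicate c.1 (codesOfMask c.2) ++ multiFamilies cs := rfl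
    rw [e, List.map_append, List.sum_append, ih, List.map_replicate, List.sum_replicate, h]
    rfl

theorem mem_multiFamilies {cs : List (ℕ × ℕ)} {G : Finset ℕ} (hG : G ∈ multiFamilies cs) :
    ∃ c ∈ cs, codesOfMask c.2 = G := by
  obtain ⟨c, hc, h⟩ := List.mem_flatMap.1 hG
  exact ⟨c, hc, (List.eq_of_mem_replicate h).symm⟩

/-- Checks that the families in `cs` prove that the family of the codes in `l` is a nonFC-family. -/
noncomputable def checkNonFC (l : List ℕ) (cs : List (ℕ × ℕ)) : Bool :=
  l.all (fun D => Nat.ble D 63 && (closureMask l 1).testBit D) &&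
  isUnionClosedMask (closureMask l 1) &&
  (cs.all fun c => isUnionClosedMask c.2 && absorbsCodes l c.2) &&
  Nat.ble 2 (multiSum (fun _ => 1) cs) &&
  bitPlanes.all fun t => l.all (fun D => Nat.beq (Nat.land D t.1) 0) ||
    Nat.ble (Nat.add 1 (Nat.mul 2 (Nat.add (multiSum (fun g => bitCount 64 (Nat.land g t.2)) cs)
      (bitCount 64 (Nat.land (closureMask l 1) t.2)))))
    (Nat.add (multiSum (bitCount 64) cs) (bitCount 64 (closureMask l 1)))

theorem exists_bitPlane : ∀ a < 6, ∃ t ∈ bitPlanes, t.1 = 2 ^ a ∧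
    ∀ m < 64, t.2.testBit m = m.testBit a := by
  decide +kernel

theorem isNonFC_of_checkNonFC {l : List ℕ} {cs : List (ℕ × ℕ)}
    (h : checkNonFC l cs = true) : IsNonFC (familyOfCodes l) := by
  simp only [checkNonFC, Bool.and_eq_true] at h
  obtain ⟨⟨⟨⟨h1, h2⟩, h3⟩, h4⟩, h5⟩ := h
  have hl : ∀ D ∈ l, D < 64 ∧ (closureMask l 1).testBit D = true := fun D hD => by
    have := List.all_eq_true.1 h1 D hD
    rw [Bool.and_eq_true] at this
    exact ⟨Nat.lt_succ_of_le (Nat.le_of_ble_eq_true this.1), this.2⟩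
  have hcs : ∀ G ∈ multiFamilies cs, UnionClosedCodes G ∧ ∀ D ∈ l, ∀ A ∈ G, A ||| D ∈ G := by
    intro G hG
    obtain ⟨c, hc, rfl⟩ := mem_multiFamilies hG
    have := List.all_eq_true.1 h3 c hc
    rw [Bool.and_eq_true] at this
    exact ⟨unionClosedCodes_codesOfMask this.1,
      lor_mem_of_absorbsCodes this.2 fun D hD => (hl D hD).1⟩
  -- The layer without new elements holds the unions of codes of `l`, including the empty union.
  -- That it is union-closed is tested by computation.
  refine isNonFC_of_codes (H := codesOfMask (closureMask l 1)) (L := multiFamilies cs) ?_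
    (fun D hD => mem_codesOfMask.2 (hl D hD)) (unionClosedCodes_codesOfMask h2)
    (fun G hG => (hcs G hG).1)
    (fun G hG => lor_mem_of_mem_closureMask (fun D hD => (hl D hD).1) (hcs G hG).2) ?_
  · have := sum_map_multiFamilies (f := fun _ => 1) (g := fun _ => 1) (fun _ => rfl) cs
    rw [List.map_const', List.sum_replicate, smul_eq_mul, mul_one] at this
    rw [this]
    exact Nat.le_of_ble_eq_true h4
  · intro a ha
    obtain ⟨ha6, D, hD, hDa⟩ := mem_biUnion_familyOfCodes.1 ha
    obtain ⟨t, ht, e, hbit⟩ := exists_bitPlane a ha6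
    have := List.all_eq_true.1 h5 t ht
    rw [Bool.or_eq_true] at this
    rw [sum_map_multiFamilies (card_codesContaining_codesOfMask hbit),
      sum_map_multiFamilies card_codesOfMask, card_codesContaining_codesOfMask hbit,
      card_codesOfMask]
    rcases this with h0 | h0
    -- The check exempts elements that occur in no member of the family, but a lies in D.
    · have h0' : D &&& t.1 = 0 := Nat.eq_of_beq_eq_true (List.all_eq_true.1 h0 D hD)
      rw [e, Nat.and_two_pow, hDa] at h0'
      simp at h0'
    · have := Nat.le_of_ble_eq_true h0
      simp only [Nat.add_eq, Nat.mul_eq] at this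
      omega

/-! ### The certificates -/

/-- For each of the families in `fcSixTable` the weights of the elements and the code of the
search. -/
def fcSixCertificates : List (List ℕ × ℕ) := [
  ([97,89,89,89,89,34], 1271029699993796466594150567897911102760065976795952787712962621235770348219523036205485030396870614856851794370597307384570833615163266351309669611603077734361038280599901494590680044),
  ([557,557,517,481,481,438], 2962942316733274125254242438123838920678792582911928761365791942478746628296399597889538798179069495536421623691144633300207337380409524899521118909107),
  ([32,32,31,32,33,0], 39289906397704794901304473231316396256523563236017063424820207631928626479004286919302771031272183620789472650640593689505828259356058026131),
  ([5,5,5,5,4,2], 9298912264614906868320384000835788893593523819905826061059484967453137419198979460879420996543021633905705541612221985877286241543249303),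
  ([16,15,15,14,11,11], 29180882243183920040132304444764563647263377893534241700857909720281371761394812887930553399356941866297670406853496170385),
  ([31,29,24,28,28,24], 123316232254903872096047307175082068723322067764216506092541590533863175265267189799440313488842218594753246761253702346065357),
  ([176,175,141,166,166,166], 2963514587610878343069710876001037763149972821343452900978465910097652614349411019576616407506062021591176504397859766994663569909252080674118501486432),
  ([16,13,15,13,14,11], 2201022218666938745034397506328935206319196654211859089168818494457906179567405736678988492966383542921972074284793908070252774993174),
  ([555,555,560,557,341,414], 52894802649959271924346091022926591732792047398281045329407163149049491193871925667259752768207802080199947776722225184432672952896682368911781878549116236665),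
  ([193,195,192,155,181,140], 701303409966110273042667529529304682638783284076797573411556043787894758917991645740555372827684502999774532341665726524642747620576868251835513315),
  ([181,148,180,180,167,134], 52889213576362962526300893218897542065337258337907815542985873026628609863618441569470790314073110820876071222312816961258164546683158237885023681168129906924),
  ([34,32,33,33,31,20], 223456939363223923891343018544485046337184062738078638479761242443629297238529745944979983584750280506790227498035863052690462838130702616910690589503115481662049),
  ([17,15,16,16,16,16], 520914046758119483664865485925250143383773561598280673989997418464340396022523127235125234915420161016013141638165304622324295171),
  ([1,1,1,1,1,1], 5130375980747654015053561257917588767255447261736939495798976938426051775890040844187082231292390560),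
  ([71,71,57,66,66,67], 2962845077878190804915388245082506953370477105333976150299291684476598980137051146527443245522932045907923730814102620367538201240671378182128946121591),
  ([15,13,15,14,14,13], 123304040040079725446049904555928646804950282585545810746798997217042217237043938125836721267173768466632231774621024537041315),
  ([181,181,178,165,165,130], 123316232466283235433912981729770406909894130232609724969342796852435842173967478106375336842551694505922278431214688864454190),
  ([85,72,67,67,62,45], 12518704527920342305318300136751939286158109445083138119687574023025510260312622940985552423620223656575563236650024977725635462941527667147357161258734440),
  ([1,1,1,1,1,1], 213477026690566636850218983107975393198267042210717855786211536336652014157),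
  ([5,4,4,4,4,3], 9298268557413538893857375693466482095719582390138666837726021114991349742049322792557428966247111561145281451741101814886759161530543197),
  ([4,4,4,3,3,3], 1214387457488467217278173044774965603320279081034551781479003060133352836020963929074867644521877),
  ([86,79,58,59,61,63], 29180775975533545916734890330370789750324355124838898716780359222454865737994006569155051957855219533142354814422991406790),
  ([84,71,65,61,60,60], 165980518191113976648538558438132629428500709976790569986872831055447314026626161032682996499890360302012077758966843132370832339781331340728815),
  ([34,34,29,25,18,18], 123289674064380125988408259599500057710489071837871498663818522229875656363465602372082142252844055964337916221919489922648256),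
  ([88,83,83,62,55,22], 386961100978237123103727485313828962376579269765564117880790205993913571477740929670427182542027352633854844737),
  ([33,32,32,25,19,19], 2201054281352888363105336301255158211051025896792903127757352916659269789879426614438760788908079060587923275741307171337176976133749),
  ([34,32,32,25,16,19], 165989582737366199639371964656842935149771416991960494313129705869127949925931400232649559338981802493695523332830325978184849973104500082114160),
  ([421368,399152,326642,333141,333141,304622], 12518020356953226900287416938290760328083413299751892549955711239042758087421412739748880853720288500471282343955295056499271738889893583616892033547022595),
  ([28,28,27,22,22,17], 166008317611422146370992683288324474239010802817226811698395097957842119457223722317491710714576142784447667137713480061028494491303315390135440),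
  ([105,105,98,88,80,73], 2962855828173088119927357845362780338355265266543599229944660917284808680591923037788462505128293414226589351890102378832801781737576168961265217921055),
  ([39,39,37,32,32,32], 2963265951393354606740791132658278580506321465806216015550997085662811981024436092975408302987517247979141645379614488436802755051234665578710810775607),
  ([2,2,2,1,1,0], 670026118316748186348174304653451380853531937502118265003559),
  ([4,4,4,3,2,1], 68024586021557962636868165378624726703751965331654578549651679887276792840748042423971112),
  ([33,33,33,19,19,19], 1214316755222119041625378956312146728419493831675666951350823154392593347607354668857864332304231),
  ([131,128,111,103,69,81], 165981719318514815887497489257821213626918643924744113490005063832420201353558285913185856759601173913793428682474755481068819758406756217924931),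
  ([703,659,662,587,429,135], 1635086407666938414091762220779549966682348014661137659023057934316472490909836823446820945186451431145150763845971),
  ([17,16,16,14,8,8], 520967164167873434432786135822457836282526403999996957495062636101346321710499435526351225766531614791302914679546844582626817097),
  ([84,79,79,56,61,39], 2200893969746658633171416684225139029919152212558930598402503240386883011692888940186702918580546221642427830960938636454841361865875),
  ([105,99,99,53,65,65], 6907245953930522632821802788515072016456115991019211360075315977226818064380689678392658435299085374434989194139858094),
  ([11,10,8,7,7,7], 29180669699851363470004500142120323985236531029918009762518014691431802322581058774241860807842138622024857567520013385321),
  ([682,586,543,463,425,315], 2962920734276138892739129889676832834128287834419458807582341472621792272829583498055829339299922210068386181408609863637587176335986416205396088923428),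
  ([116,100,93,73,73,73], 2962855988474083103617032256604574826748503472371531126867311559485512839256666651109974381781898802628905560054954694795929711977195184642441672455982),
  ([18,17,13,14,11,11], 5130488015907265552674406372096505177461828846404806933540298532771337272682282289746101491500939845),
  ([423,423,449,408,381,381], 1634755851450147816737986324960499753456983565770238231644988120200103832904410507383195352628288000269057960535978),
  ([206,185,185,162,130,130], 520902652910340156836939327989613044229906993212056941587699153000254421298657497532892075561972766602095257669852599874354365321),
  ([673,611,611,425,425,250], 287416421338444986318837674675174895173971632531356544663790657978103006320469575312953887124),
  ([84,81,70,67,58,39], 21675681479928014389448958658232354962574308231210597257602617017097703898638916362213018089137897772563),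
  ([36,34,33,23,23,11], 6906717691252464700205782192499929936594356661640046551235392025294525720524752329159448929233867511466512424230052246),
  ([357,339,276,307,281,214], 12519616699415175725283322762432941610606178820200280838413899303655936766531631402513943040715902932076995574193863643652441741536264827629265515694616690),
  ([581,581,380,502,502,475], 386916006323693224681315477413052484658987926196851808276246125663652470830671400266072631354848927452108793631),
  ([55,55,43,45,39,35], 9298302900239556994840300810920133150894989956712836595355211997623947715194111095572459924656321938300975765133155076783771668793306945),
  ([15,13,14,13,13,12], 91579754291584476445989221341824899923885639713419474085918243712844693322474479548527699689216825912353815),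
  ([80,77,76,64,54,49], 520967181830573719757426700021115334598939765588683884964988817435186164110360196241763687961071019544353925633265214849427398484),
  ([48,46,43,40,31,28], 701265135298640850402937261685191001844343586809172315078517009092893096136833715805677784012918190942049236434636437202016290084804277022441721627),
  ([29,29,28,25,22,14], 52896151077021859878652613056310630609946745056902502250698378376609223625410631634265599587172911140441828001769712453549842661118338695812076098267729279253),
  ([199,192,181,152,152,130], 165991395743553455206911127865963829455723890006494003820961882702028465632051566948742065061430593622692501190024893659336657968576403977752575),
  ([191,191,177,158,158,108], 2963276686335081089616002367183937326510317555606900868930550550127520626336306855494576885285902297249989804443294072076794188052435610038314257188565),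
  ([565,565,522,472,470,321], 165980509264591957405435507039347458453351134879458853076592466986918304774032747719403071528942078346872071383645499884652901314399163897813565),
  ([167,167,162,145,112,101], 701272760493663929104486624052747624149002465608454689564819101324228387399577252172453218580265009824632253131359395716277419382632483025260361915),
  ([77,77,75,62,61,52], 166001066445238538429575965785817840371281956874998077003365036459946736034042312669090690743431061353639070896975058561736899348809064689158355),
  ([696,599,559,528,360,252], 701313639762152505687515058468954920393409638878014751434683976578752818197834117744036921019766083537573914384366120414608773516393694986380422801),
  ([93,80,75,65,63,29], 165991399671892273792227216533262025662848761017006554113163765792794885294469940184903513082504954613877602613802278198894478176304744028471001),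
  ([86,84,69,72,59,29], 91588426274325282219168002681714661798529066301203827410031253049643139756620041346555903931069727182051472),
  ([69,68,58,45,47,47], 5130525417019346698092819030477078208454660943719195030024377705551234399733138127201888618603665664),
  ([36,33,22,23,24,25], 5130207841699635316504998524870588850504513926627693178663814857345501646819368577694939306455714982),
  ([5,4,4,3,2,2], 68026566396873563090200642111648025274116856733675845683802538102357582284206366340384192),
  ([695,567,536,476,360,338], 386935714526886061404755449437504576470920544907351136731194189185910686521360202715965530781126326304102648681),
  ([35,35,20,28,21,21], 16101197073070984347203829323116939431814346887573280614954573445515756114503269866777),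
  ([89,83,70,59,59,37], 68024582341712143415351788358687022721115037041649886940301826919931616992341084709897051),
  ([78,74,60,67,67,38], 944095214653486388226481709934288940735103039068969872537035665171139174159606494964839664741363070521067427199048088227805929641591123010703398180750838811494945849),
  ([458,397,366,298,313,236], 223505770977492592953751167059526940543009432009922917569495458079751408902451485337166034656592723003040728561879737934118997541503411191123334021706921034378620),
  ([82,66,66,63,57,37], 52891527980805772651676976799251131119909699765490295259796265427124937444017099615840335381586296702440610988372968688421283434990746414052069559730238993689),
  ([101,101,67,94,76,68], 39285329742602923593792186011163766552059599294271455140406407407759788284545565935679858274713346274706951764768656296890660297870236411581),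
  ([79,78,50,74,67,51], 386944170100345140754317123111790330846700928843627574581246614885282576956920943549999339474887170287299055127),
  ([205,203,160,184,144,106], 520921649478806652641943542702749759169052949360595744036738550960442882430556762478599009433477633037615768389393368972941018806),
  ([32,27,30,29,23,21], 520906472103641543589178419158141161199368612496505743690632840491686998031551261402483871002404268182510553037428402490969598909),
  ([12,10,11,11,10,8], 1634720060440708706444038203689337174885017133520069511914736773490256605973933083301775370250286975092742615415357),
  ([16,15,15,14,11,8], 2200829732117957000127071110104222958438488580411834555619988358386813225450233233814338566528094593378422768015621452150948341926504),
  ([31,31,20,26,27,23], 2200773630645503704085672529851361144531739910696120414135927901898442936471668973904544015265425615472315141325108922790166937379071),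
  ([75,75,59,63,53,53], 165988981643690540136018288647288855754338110067925747861452672602668588151380724551429899520037453174993172236250549957033368093419159665877135),
  ([30,25,28,26,25,22], 1634731996420901346313185252958738048143872678800754782129192858105976627723855680644783718637120192985272220524310),
  ([587,569,564,497,406,406], 6907849538353494185709632330761071537974132889832454556527584195408277077944749054041331256501949784067952480023928010),
  ([20,20,19,17,17,7], 300882544215400812759199309366918757161315929056283588506265985529842580616899766010422041185987814189464729895725088250774259028641316468424758341036121514552915475326737370285513),
  ([566,566,553,487,377,381], 2201271459808656097956653889477959510084895522239043440910465346491966120385377926729022335009178179926856864450195903980720386640672),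
  ([22,19,16,17,14,14], 165979913715372139100039818222322496441600859841748597083347462273552256010203147011435796631874578119309774239606236038437287690959826144893482),
  ([264,228,196,187,185,168], 2963007063359900283907002608599540008542708078717961868395200532233073377776501865858694400736286847872063505523209789193112609200987319746144480714982),
  ([10,10,10,9,8,7], 520936799427996498145915006067097384031467434661398120980818397026751252158758274760318332453787841371542905754875105823739280982),
  ([111,98,111,102,95,94], 123290572987413722541057867897681535791661777221366538008224299948444738593904917989010922491699589813563022975476897956252089),
  ([20,20,19,18,18,14], 12518020953379208734576564139034865004673574794455144227262624960308756704123961260902567716333360673238425429634156312026901596252391234624602629452096057),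
  ([551,485,544,504,505,422], 520925422647740848388252657499939427702161755948086537247909985037443348160985913322413385694596234231990569240198457282385016690),
  ([70,60,56,42,49,44], 165980518241506329369995437270564907337358728729281338968470627839634977319918321549812666235134326771078730484202691739550714592721420527924732),
  ([23,23,24,24,22,17], 91579082791312050786933608080778025798915890677970352644744550038965874684068609167992151667260286067239263),
  ([38,30,30,29,29,13], 223468324262478863754216368695867718276684021215409624945391311173484751534988537624871124855681723728133530007976594926267093655075033483736318533280906644794259),
  ([47,38,40,33,33,25], 9298776528778940974766313607794071292397344166280450081917943639066699228829361217882691625105646225518160879592679852521832412539957459),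
  ([195,195,125,188,187,109], 520898883392039550865944832782688827716305265724201210335645844433717622947487842190950855989012312083944212974123289856989719111),
  ([11,9,10,10,10,6], 9298370411392817567862977896027105277351199249550077555337093211329714243494262987601585589070899367957882404286009315913227340721023709),
  ([39949,32025,32025,28369,28369,28107], 223455300992429787420296118916040357988958019010784197802256727486803085891270798406688513704486997333838149824049592739659376251878400103432073687829081842263472),
  ([10,10,10,9,9,6], 12518340100321916726114604684482397623027795033436359581891940588881095964806028032031444986311232350533729033179002578035510969656578055131456765339000569),
  ([70,62,69,64,64,50], 701272759884720794487965952001641787097612099373955720000097790247651121751403274708463965524656199667013357729511473452092650343734718354952635440),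
  ([127,110,94,98,90,67], 701265099333495364782689228417730821308629074166090794267688690233222673717404132673372111182588987988921574849434125255124484546065678954410346607),
  ([85,68,68,65,60,54], 2962845075333154238224603165949446415966323315406472670277790845849931935043896523392914795833447416837192867522542189839001167818364636624808416090465),
  ([10673,9089,6584,8434,7663,7663], 12519798396442473473845277949716057339236866810683491475127593675883967039757614336980187176516523464844852856207150654184519748568609254319975861167112232),
  ([4,4,3,3,1,1], 68026814030624992435998251265074378196686050461270237339194133364738829913149944058269297),
  ([18,14,12,15,15,9], 91577753014886994517202869818516353922263263429572460069488868230374813696148443303424320038814838033678830),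
  ([1,1,1,1,1,1], 68023345876522958955149981701682079841249555524054560425157797345856032225359315933913157),
  ([9,8,7,7,3,0], 701405579124463794293512278033435389787762497949062865813733732381775937377764888783389766457135143993859466962114910815555914529418796481570883672),
  ([4,3,3,3,3,0], 5131086004262720062355099977196325673087321928726412429686141507079231237833455335507513050537881541),
  ([38,36,28,28,15,15], 91589093407763164672131832824598812037806503033799945470069332431133512489290766519962602280776103807668107),
  ([94,93,78,61,36,36], 213501118174722324822428231489228012775380460712398499976596294539983534527),
  ([325,302,268,268,89,89], 2200893969715221431904897689015415342926594195621577787860626396880228352692578782909962058670476256874976826710766996374634641967971),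
  ([254,182,145,190,176,113], 29185663796439327998935618723754301882180786995223770215966106598326493158357077446926308228470536166257024863200279065357),
  ([39,30,25,30,25,11], 901983099881765569212407163225869909715126035694400097924139938528563230745996),
  ([36,31,27,29,21,16], 91583756735600769153242034455818537609634208445695912983875355982126755597791302782015875921662197510470846),
  ([77,69,59,56,31,31], 2200773735581720702420774187664243290138569896050424062096892801883688041308669315042454307350748316815275698087741227625759412199357),
  ([117,75,75,105,97,33], 9298302896854990133371736892690603716949290521799708631097603257677093399186847507035703998963594629472795929976830018753246151408495526),
  ([18,14,12,16,13,5], 1634851026470192682447079059772698558018496515577389382060143262565794356524176631787081918981173932730465559377046),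
  ([92,64,64,75,74,37], 1214254782491325040978454324158662800931423082696811571960048559342582439330930925805563268438348),
  ([91,80,72,57,50,50], 165988972630957510287236699635230191801056898700635485380076080646853522874597455974954320795063118505354225704471648624493155167568323894925202),
  ([38,34,29,27,16,16], 9299386289997800644823757428420161854581249642943052508320633637902136852674465877869730545122157436590336850132463605349129299368613477),
  ([15,15,15,15,11,9], 1634851113180231615049920931202796137506508663966880056365650573785577633572350851311284010728536104312963048468328),
  ([87,70,61,69,61,48], 387002576959191420742574877398159550993404768611599111020004676391401214083046034721526132378246174390298919680),
  ([84,72,72,56,56,57], 91580416398716703459178974232645500532288855698182108708482443786581655414946782000382474819083928231652749),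
  ([66,58,53,76,76,71], 123289676538444580761695972800079167969355359599864154506142398869939020270660898415812525890052231713303576788868139968032695),
  ([10,9,7,6,4,4], 68027063503309205516254169457242742275189445713815410649636921357962288408077983520684232),
  ([3,3,3,3,2,2], 11961716181847267535092266990576462582119290510616574016646439282657),
  ([9,9,8,6,4,4], 2830932431732560661915389613214224985228893033024966103842543277),
  ([5,5,4,4,2,2], 2830685159095733366693390890720027870939653369413472548333521402),
  ([20,14,11,15,15,7], 29184176948042354759983825474973426572194700032543070483809597473331288510967191366531397347684591596901751939857777426451),
  ([19,15,11,18,15,6], 5131371688911560267459071914561821095366843714292714923288621988262435248439550656868682711521604921),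
  ([5,4,4,5,4,4], 902038952514321745500044087488788395127727631634790539742558731066287305790159),
  ([93,82,73,58,56,40], 9299589801543633995462298022625996105060313642104518358868963449602440975241313210495349663912699799382406299967069729654672780095782957),
  ([38,34,29,27,19,12], 9300400308907073091243123049440360843459170173511293186813379019745317153198022832953732394634837380301455983664365495657207324289970587),
  ([93,81,58,73,56,42], 520953901807078254185044240041684381931673372947867020288481011718600049730251348361881521390364561053765654897280963579403107107),
  ([233,205,145,182,140,99], 2201182413853580797175613262199596148695400513690370047224568162783950962054293527410580666784680822501674514826797726915949910571607),
  ([9,8,6,7,5,3], 9298573826750507198309517307664022315060082271348539417541493189104679495322134433287227924620662388872208632561037558021890627282471607),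
  ([295,295,296,296,247,155], 39286472335393064516295483362657599832229742338364599447556431384805618741125478528131069239761755639556155934307696373428323200517848271456),
  ([10,6,6,9,9,2], 29187291892558063206166819706898483198671620225814374544724958736857631219443193928957845349876015233331176570226856812448),
  ([94,81,64,80,64,17], 1214391888362314867268441727868049272241672302965655380646205450073172726404013992696304160049547),
  ([14,10,10,13,10,6], 21675760417991186181458779811428413509188185665555795251885936089015140659587697806314477175473871398403),
  ([30,21,21,24,25,12], 5131371688911241660403609309023998925396949087082583778043969803379895422262661701310860457747114830),
  ([89,64,64,75,64,42], 21675365707039942417194922421215870140030439057557723392034553586576243620701112599611883278967323152443),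
  ([549,395,395,464,394,260], 6906692538150967449816973000680900849644413607125208246078866134076124720537147197753202363555988894873295572506292443),
  ([8,7,6,6,6,5], 3811322813228346745839191817697504886778592080875174275046564050401385690680068926),
  ([218,185,151,161,161,130], 68030531996206047344290820336230881875115976932374106717358128067616582740524740967909698),
  ([3,3,2,4,4,4], 901943701743965854239115355816200217910892109099277527692046006191104774921682),
  ([188,170,142,191,152,153], 16103723428230915449995719880127465599485766921411700943920440607741534283150543819470),
  ([75,75,75,75,53,47], 91598201858742488124463369421485146718307805563267835350742581439946962641506722349372683181108587438139857),
  ([133,116,105,154,146,119], 520898883319662313479847633579453126237762800001829589855957747797806588590311135724108697663522331394526983860141773059116205506),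
  ([78,78,71,74,59,41], 6906742846746794898679062333541619277290779672101909015805153435764704204619631376649436437974911342372248504541002003),
  ([15,15,14,14,12,12], 16100493722746113371330537613150838594080605432888712565372583701612412908997358600882),
  ([145,114,104,114,104,75], 701424948137187802839849637477404088529018723232968918904418144558916051957113267792600978430033016385648248027564662773278263680732763730933043700),
  ([14,14,14,15,15,12], 165981116223173802852996608858579311380609780863353172263674193191079505370337371729660184049913989845638297433563936363809461106738933789439807),
  ([69,64,55,72,68,68], 166017422991734418756590462579790021499159777065196475699179651684655124656092518102439248254471191101748881724669034593782444251091666061340724),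
  ([93,82,73,58,48,48], 165984744237763791994482845482857328392902454823361905468659148419580388214853428541069936727276793392767237069008318146062891533398976774790002),
  ([74,65,58,46,51,26], 52896151065842054614423480942189757706163470098840565146970519616895356053957754089145000377155994644652513870173276337209809787534527891626800793790334236132),
  ([3745,3745,3747,3747,3458,1562], 2962855909923180851221632826322346543576471046855416967030130494664962554372397824595413816844345595771633246048062692975722235475082300417227153772961),
  ([3,3,3,3,2,2], 16101431954487606363116897968736195678444403868658800740204406051146024599999503789598),
  ([53,34,34,49,43,16], 386916006317140840929562908302999465589200539251005453395814312489715188976182230926309963995340424052166340313),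
  ([60,43,34,49,36,30], 6907145025498317150249180835840045009218460141357183348078054368610245423935308386702119836619453632036293337722735204),
  ([36,26,26,33,23,16], 21675286750004245955773873769774522569855186672426215781341585328248213886155076390331467841513167304653),
  ([20,16,11,16,11,6], 1634731948508128429036176452528537021643831618603192831228015998931008955136614911057918848442052958976723319045947),
  ([240,171,137,196,145,123], 123295064954254260066900744875548816730065526743579775404512775030682639479661409065617141624392067828692027010528177331400428),
  ([16,12,12,15,10,10], 1214405206094042665668477492078354620545500154982585819563587092202580418103162533645530693806153),
  ([87,61,61,66,75,48], 16101901063316924411836916493654982875070263375532636077048177762534058624845783289080),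
  ([634,486,486,547,391,473], 1214524759094142679100231436922553702325505167408297461644073266296183938650367580796956843037153),
  ([26,26,17,36,37,31], 21676944001672322921998537219464249543046170761465454598587652843354828475372109109160523248061138619165),
  ([6,5,5,6,5,3], 16100962842967831148883665218336487327716773640099367818411418159961083271709006727252),
  ([25,20,20,23,23,23], 16101431574168618800347583573803206372437327738517923164976803658935219876286118313627),
  ([38,29,26,30,29,8], 12520163812621944346975116133072972830063328573467928930673221700179508411562224512027057694657797760420347004343906284144451511923626382132363077329734688),
  ([64,43,43,58,48,48], 521011518638413712488069591156920228770924871605811274330699775533464876482568061445460463658070935360085102675757364350104031280),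
  ([113,98,90,134,125,114], 123295963020797019889241686253309435438737787841219370403876338831093779980368864820887874806625508189625459632450741400078640),
  ([190,152,114,204,194,157], 1634928431362933951589816933509238165513528450950423997506593166626640474319964308398259055613250896471537749233128),
  ([24,24,28,31,29,24], 21678206551318549807060253741283752485056726774682092675037722018539319645675970903293913795758753359257),
  ([341,268,244,268,244,157], 9298268557413784963207163996062525713524165683987188589435404248028574718078745815850342825763189189551005641255247184475902404271576730),
  ([72,64,72,74,61,55], 21677733594835943827280929729741612922533131520047321376422372452117874660003495014578247705367929864502),
  ([7,6,7,7,7,6], 68024088775221244946292195124369713750810242482846547238633443755574182968268418874005882),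
  ([4,3,3,3,3,0], 300875978099880816558039782970856735316252694186561646006878591636361553179655967413413199840349049964801088261555229826473248872234195692467015628003631681264613388381206014459291),
  ([61,61,70,78,78,52], 123302249607141465091062266709930426227614631800346995515554545044809191526578774730463116270427920348824527192012395004070920),
  ([89,71,53,97,90,83], 1634755850541228697779153830191230692988312493577237317217578478767476193975883544350840239633978709591589052953987),
  ([58,58,69,77,73,65], 5130245123369638082025524567561170669309733334342389543063495595117393654248790496758068071790827782),
  ([255,179,179,204,204,163], 12520860430852460976454665868099864685089079699938793471417920138739830818047477702065272808301010464149926691702013650694341123941317982356828532847522721),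
  ([522,522,343,558,558,528], 71202875995877996722159155890569435016183267815066311801904235102810445634772849730593575267178507926223928158972643470087249896511912347882860802069584298571482573230755024307),
  ([5,5,4,5,5,4], 29180987063799731388485981676806007737718616804011937115227402437140955669770937677325832177841125581004275586176569394125),
  ([3,3,2,2,2,0], 166008326438562848670431505030205269776497462545082096060323271608016920700438200963269836101428850755157099985082113881421577291596061518861883),
  ([1,1,1,1,0,0], 50538315244988120822580645847424271068055807402586133055141867956845566),
  ([11,9,9,5,5,0], 1214405205744081558484590833678907068433123857940772569144309773897273312929967272341089756750984),
  ([21,17,12,11,10,10], 16100493725147442841426345730295981407148777452451284492774364207834954436799495739771),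
  ([4,4,5,4,3,0], 3811114724247059161806134881125612368029425386480586296089963998855915613264607224),
  ([82,83,50,89,51,52], 2830530521917049688236889807703533516757899086488340734687547918),
  ([45,41,41,33,20,20], 16100141895351051297039452060658661167534211098392057198558957876531205636037231182752),
  ([488,488,652,325,522,459], 21678838368010809204120299631084417909045995069568651274006601338754357179261019704178182805188707630282),
  ([38,34,33,24,15,15], 3810892658047850215544668616210702247908904955510003475384327957281772563856162546),
  ([66,66,88,44,69,63], 16101080115775747683213871828792051652475399915050078093904230490134237500485579270977),
  ([26,26,28,25,18,15], 16100082707089254506693411660049826680885610010873488134545101077639245319299474021657),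
  ([3,3,3,3,2,2], 2830932581337452559071305584076896640381979289125142005546463157),
  ([1,1,0,0,0,0], 64),
  ([1,0,0,0,0,0], 64)]

/-- For each of the families in `ncSixTable` the multiplicities and the masks of families which
make every element rare. -/
def ncSixCertificates : List (List (ℕ × ℕ)) := [
  [(12, 13835058059577131007), (90, 18137037159124939571), (90, 17262173194267102991),
    (90, 16789279771400831231), (90, 16753672087327014911), (115, 18290760026942723413)],
  [(36, 16753672086790143999), (64, 18290760576161666389), (64, 18137037708880753459),
    (52, 17262173743486045967), (36, 16789279770863960319), (22, 16177071153053958143)],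
  [(59, 16755791951508275199), (102, 18293020622178342229), (102, 18139297754897429299),
    (59, 16789288566822764799), (59, 17262173193730232079), (59, 16755923886469611519)],
  [(36, 16762547350949330943), (63, 18299776021619397973), (50, 18137045955083744051),
    (50, 17271180392984973071), (37, 16762679285910667263), (37, 16789288566822764799)],
  [(116, 16753672086790143999), (199, 18290795210777941333), (160, 18137037159124939571),
    (157, 17262208378102320911), (157, 16789314955236049151), (70, 16753566539973656575)],
  [(23, 17906461656301436927), (31, 17942210071429611775), (32, 18290768822364656981),
    (32, 18137045955083744051), (31, 18415094698337079055), (23, 17906593591262773247)],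
  [(12, 17185876919829135359), (16, 17221625334957310207), (16, 17186017650883493887),
    (16, 18434875214347490645), (16, 18425267535142433587), (12, 17262173193730232079)],
  [(19, 17906452860208414719), (41, 18415094698337079055), (41, 17942201275470807295),
    (41, 17906593591396990975), (43, 18290760026405852501), (43, 18137037159124939571)],
  [(12, 16141147359395446783), (26, 17262278746846498575), (26, 16789385323980226815),
    (26, 18290795210777941333), (26, 18137107527869117235), (12, 9836143059149062143)],
  [(29, 13525351140697551667), (40, 18290795210777941333), (38, 18415129882709167887),
    (38, 17942236459842896127), (27, 17906593591396990975), (18, 17293998495258116095)],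
  [(24, 11068045859975434513), (8, 18415094698337079055), (8, 17942210071429611775),
    (8, 17908845391076458495), (8, 17908713456115122175)],
  [(26, 12659494374557585167), (36, 18299776021619397973), (36, 18425276331235455795),
    (25, 17050909662062379007), (26, 14771675933760782591), (25, 17050777727101042687)],
  [(121, 13525351690453365555), (129, 18290760576161666389), (120, 18415095248092892943),
    (85, 17942201275470807295), (85, 17906593591396990975), (55, 17329992657660805119)],
  [(50, 16771580938483138559), (105, 17280222776611802895), (113, 18290795210777941333),
    (113, 18155051557634421555), (80, 12177628936808661247), (80, 14465843476085932031)],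
  [(47, 12150861882277756927), (139, 18299776571509429589), (101, 13525360486546387763),
    (73, 12659494924313399055), (49, 9871759539315900671), (47, 12150993267617497087)],
  [(9148, 12285996259377938431), (26067, 18434910948609611093), (14012, 12650522909430746895),
    (13638, 12321744124884517119), (14012, 13525351690453365555), (9148, 12286101256438611967)],
  [(535, 12295108455693352959), (1020, 18443917598108538197), (535, 12659529558929673999),
    (535, 12321744124884517119), (371, 13525351140697551667), (371, 12295002908876865535)],
  [(24, 16141076990651269119), (71, 17262208927858134927), (42, 16789314955236016383),
    (84, 18290795760533755349), (71, 18137037708880753587), (24, 14411800280549097471)],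
  [(124, 16717643290299662335), (124, 16789139033912443135), (240, 18290760576698537429),
    (194, 18137037708880753587), (194, 17262173744022917007), (23, 16717361821094248447)],
  [(23, 16861617746658459647), (41, 16933394958939783423), (74, 18434875764237522389),
    (37, 16861758477838647295), (62, 18137037708880753587), (48, 17262173743486046095)],
  [(31, 16753672086781755391), (73, 18290760576161666517), (73, 18137037708880753587),
    (32, 16789279770863960319), (59, 17262173743486046095), (16, 16753390618113212415)],
  [(23, 17870564794369638399), (25, 17942201275470774527), (39, 18290760576161666517),
    (39, 18137037708880753587), (37, 18415095248092893071), (14, 17870424063189450751)],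
  [(105, 16755783155415252991), (250, 18293012375841134037), (250, 18139289508560221107),
    (105, 16755923886461222911), (203, 17262173743486046095), (62, 16789279770729742591)],
  [(40, 12105957271872274431), (155, 18290769372791559637), (67, 12177602549066432767),
    (110, 13525360486546387891), (85, 12650487725595529103), (15, 12105825336248238079)],
  [(83, 17005593290986225919), (66, 18290760576698537429), (60, 18425268085032465331),
    (49, 12650487725595529103), (11, 17005592197245960191)],
  [(29, 18014679982445494271), (32, 18086316463546630399), (47, 18434875764237522389),
    (19, 18014539251265306623), (36, 13525351690453365683), (34, 18415095248092893071)],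
  [(103, 16861758477838647295), (118, 16933394958939816191), (214, 18434875764237522389),
    (181, 18137037708880753587), (58, 16861477009170104319), (140, 17262173743486046095)],
  [(134, 16899757601707851775), (114, 18437127563916989909), (97, 18139289508560221107),
    (74, 17262173743486046095), (42, 18446604433602085119)],
  [(34, 12285969321343057919), (125, 18434884560330544597), (54, 12321717736605417727),
    (91, 13525360486546387891), (34, 12286101256430223359), (50, 12650487725058658191)],
  [(86, 16753672086790143999), (211, 18290760576161666517), (211, 18137037708880753587),
    (174, 17262173743486046095), (89, 16789279770863960319), (40, 16141041806279180287)],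
  [(67, 16753672086790143999), (158, 18290760576161666517), (158, 18137037708880753587),
    (128, 17262173743486046095), (67, 16789279770863960319), (30, 16717361821094248447)],
  [(213, 16753540151694589951), (544, 18290769372120470997), (544, 18137046504839558067),
    (229, 16789288566822764799), (450, 17262173743486046095), (119, 16177211334352502783)],
  [(29, 16717511354675625983), (33, 16789288566822764799), (73, 18290769372120470997),
    (73, 18137046504839558067), (59, 17262173743486046095), (16, 16753672086655926271)],
  [(34, 17870564794369638399), (40, 17942201275470807295), (64, 18290760576161666517),
    (64, 18137037708880753587), (63, 18415095248092893071), (20, 17293963310886027263)],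
  [(32, 17870564794369638399), (37, 17942201275470807295), (58, 18290760576161666517),
    (58, 18137037708880753587), (55, 18415095248092893071), (19, 17870283325701095423)],
  [(56, 17908563922533744639), (60, 17908845391068069887), (103, 18293012375841134037),
    (103, 18139289508560221107), (101, 18415095248092893071), (37, 17365740523033166079)],
  [(26, 17908563918238842879), (22, 18293012375841134037), (22, 18139289508560221107),
    (21, 18415095248092893071), (8, 17942201275336589567)],
  [(140, 17906593591388602367), (150, 17942201275470807295), (290, 18290760576161666517),
    (272, 13525351690453365683), (257, 18415095248092893071), (83, 17906452860208414719)],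
  [(55, 17908704660022099967), (55, 17908845391068069887), (111, 18293012375841134037),
    (104, 13527603490132833203), (99, 18415095248092893071), (36, 17942201275336589567)],
  [(52, 17185736182340780031), (56, 17186017650875105279), (56, 17221625334957310207),
    (89, 18434875764103304661), (89, 18425268084898247603), (72, 17262173743486046095)],
  [(325, 12150861332521943039), (1389, 18299776571509429717), (1036, 13525360486546387891),
    (784, 12659494924313399183), (325, 12150993267609108479), (370, 9871759539315900671)],
  [(15, 17870432859282472959), (29, 17942210071563829503), (52, 15984926363040994773),
    (52, 13525360486546387891), (35, 18415095248092893071), (15, 17870564794369638399)],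
  [(478, 12144132321359953919), (2033, 18293047560347440597), (1511, 13527603490267050931),
    (1150, 12650522909430747023), (515, 12177628936808661247), (504, 9838394858954358783)],
  [(95, 12153245067422793727), (227, 18302019575230092757), (164, 13527603490267050931),
    (23, 9871750743222878463), (126, 12659494924313399183), (57, 12152963598754250751)],
  [(50, 17908563922533744639), (84, 17908845391202287615), (162, 15987169366761657813),
    (162, 13527603490267050931), (110, 18415095248092893071), (54, 17942201275470807295)],
  [(54, 18014679982445494271), (62, 18086316463546663167), (93, 18434875764237522389),
    (33, 18014398513776951295), (68, 18415095248092893071), (72, 13525351690453365683)],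
  [(42, 17187987977859563519), (32, 18437127563916989909), (32, 18427519884711932851),
    (13, 17221625334957310207), (18, 10344644715844964239)],
  [(104, 18052679106314698751), (75, 18437127563916989909), (54, 18415095248092893071),
    (59, 13527603490132833203), (35, 18446604433602085119)],
  [(2928, 16861626542751481855), (3346, 16933403754898620671), (6705, 18434884560196326869),
    (6018, 18137046504839558067), (1780, 16897787274731782143), (4455, 14956330734272352143)],
  [(7, 12249940524324093951), (30, 18434884560330544597), (14, 12321717736605450495),
    (22, 13525360486546387891), (7, 12250072459411259391), (12, 12650487725058658191)],
  [(22, 12288071587575365631), (86, 18437127564051207637), (37, 12288353056243908607),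
    (63, 13527603490267050931), (23, 12321708940512428287), (35, 12650487725058658191)],
  [(89, 12285995709622124543), (358, 18434910948609611221), (153, 12321744124884517119),
    (208, 12650522909430747023), (89, 12286101256430223359), (208, 13525351690453365683)],
  [(43, 12294967724504776703), (166, 18443882963492263381), (68, 12295108455684964351),
    (96, 13525351690453365683), (46, 12321708940512428287), (96, 12659494924313399183)],
  [(39, 17906461656301436927), (42, 17942210071429611775), (85, 18290769372120470997),
    (80, 13525360486412170163), (77, 18415095248092893071), (24, 17330132838959349759)],
  [(32, 17870432859282472959), (37, 17942210071429611775), (70, 18290769372120470997),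
    (66, 13525360486412170163), (62, 18415095248092893071), (20, 17906593591262773247)],
  [(25, 17149707385321816063), (29, 17221625334957310207), (29, 17186017650883493887),
    (47, 18434875764103304661), (47, 18425268084898247603), (38, 17262173743486046095)],
  [(114, 12297219524318461951), (268, 18446134763171730901), (114, 12297360255364431871),
    (152, 13527603490132833203), (152, 12659494924313399183), (30, 12321708940378210559)],
  [(83, 16897647093433237503), (206, 18434875764103304661), (175, 18137037708746535859),
    (175, 17262173743486046095), (83, 16933394958805598463), (83, 16897787274731782143)],
  [(956, 13525351690453365683), (1020, 18290760576161666517), (920, 18415095248092893071),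
    (488, 17942201275470807295), (488, 17906593591396990975), (259, 17329992107904991231)],
  [(405, 13525351690453365683), (432, 18290760576161666517), (382, 18415095248092893071),
    (216, 17942201275470807295), (208, 17906593591396990975), (110, 17870424063189450751)],
  [(152, 17185876919829135359), (163, 17221625334957310207), (163, 17186017650883493887),
    (304, 18434875764103304661), (287, 18425268084898247603), (236, 12650487725058658191)],
  [(25, 10344644715844964239), (31, 18434875764103304661), (31, 18425268084898247603),
    (15, 17221625334957310207), (15, 17186017650883493887), (15, 17185877469584949247)],
  [(39, 12249966912603160575), (168, 18434910948609611221), (72, 12321744124884517119),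
    (98, 12650522909430747023), (42, 12286101256438611967), (98, 13525351690453365683)],
  [(28, 12288221121156743167), (72, 18437136360010012117), (55, 13527612286225855411),
    (18, 12288353056118079487), (30, 10344644715844964239), (18, 12321717736471232767)],
  [(5, 12285961075005849599), (29, 18434875764237522389), (21, 13525351690453365683),
    (16, 12650487725058658191), (10, 12321708940512428287), (10, 12286101256438611967)],
  [(23, 13525351690453365683), (23, 15984917566947972565), (20, 18415095248092893071),
    (10, 17942201275470807295), (10, 17906593591396990975), (6, 17906453409964228607)],
  [(55, 12285969321343057919), (249, 18434884560330544597), (102, 12321717736605450495),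
    (191, 13525360486546387891), (104, 10344644715844964239), (60, 12286101256438611967)],
  [(25, 12650487725595529103), (36, 18290760576698537429), (25, 13525351690453365683),
    (13, 12177593752973443327), (13, 12141986068899627007)],
  [(237, 12650522909430747023), (277, 18290795760533755349), (198, 13525351690453365683),
    (93, 12177628936808661247), (49, 12141986068362756095), (85, 17938102233694470143)],
  [(113, 16861758478409072639), (122, 16933394959510208767), (200, 18434875764807947733),
    (122, 18137037708746535859), (113, 14956330734272352143), (26, 14411659549368909823)],
  [(568, 14088319028959609731), (365, 18434875764807947733), (225, 16933465328254386431),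
    (167, 12286101257000648703), (74, 13871297962828627967)],
  [(151, 12150711798940565503), (1170, 18299776571509431765), (161, 12150993267474890751),
    (537, 12659494924313399183), (918, 13525360486546389939), (368, 9871759539315902719)],
  [(427, 11574532515171467263), (3027, 18299776571509431765), (1458, 12659494924313399183),
    (400, 11574251046637142015), (2304, 13525360486546389939), (946, 12177602548529596671)],
  [(25, 17906312118425157631), (40, 18415095248092893071), (40, 17942210071563831551),
    (77, 15984926363040996821), (77, 13525360486546389939)],
  [(34, 17329992107904991231), (127, 18415095248092893071), (121, 17942210071563831551),
    (34, 17330132838950961151), (235, 15984926363040996821), (235, 13525360486546389939)],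
  [(37, 14956330734272352143), (37, 17560576956443112371), (58, 18434875764807947733),
    (31, 16933394959510208767), (31, 16897787275428036607), (8, 13871228143840264191)],
  [(28, 18410715280985554943), (30, 18410996749519880191), (30, 18446604433602085119),
    (31, 18290760576027448789), (31, 18137037708746535859), (31, 17262173743486046095)],
  [(56, 12286101256304394239), (412, 18434884560330546645), (324, 13525360486546389939),
    (189, 12321717736605452543), (130, 10344644715844964239), (49, 12249790990742716415)],
  [(718, 12250072459981684735), (2261, 18434884560900969941), (1184, 12321717737175875839),
    (1220, 13525360486412170163), (826, 10344644715844964239), (211, 9799982327034544127)],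
  [(75, 18434875764807947733), (37, 16915801673937518591), (189, 14106333702346998659),
    (33, 12321708941082853631), (31, 13889101255105576959)],
  [(12, 14735919272295399423), (40, 18425268084898247603), (59, 18434875764807947733),
    (28, 10344644715844964239), (43, 17221484598173565183), (43, 17149988854560784383)],
  [(106, 11574391784125497343), (885, 18299776571509431765), (423, 12659494924313399183),
    (113, 11574532515179855871), (694, 13525360486546389939), (268, 9871759539315902719)],
  [(28, 17330132838959349759), (105, 18415095248092893071), (195, 15984926363040996821),
    (195, 13525360486546389939), (100, 17942210071563831551), (26, 17293963310886027263)],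
  [(21, 17330132838959349759), (72, 18415095248092893071), (133, 15984926363040996821),
    (133, 13525360486546389939), (67, 17942210071563831551), (18, 17329851370416635903)],
  [(27, 16861758478409072639), (31, 16933394959510241535), (54, 18434875764807947733),
    (34, 17560576956443112371), (34, 14956330734272352143), (5, 13871228143840264191)],
  [(165, 18434875764807947733), (95, 16933465328254419199), (432, 17578661999652631539),
    (68, 16861758478409072639), (71, 13835269165809663999), (432, 14974415776403918735)],
  [(37, 16861758478409072639), (43, 16933394959510241535), (72, 18434875764807947733),
    (44, 17560576956443112371), (44, 14956330734272352143), (7, 16861617746658459647)],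
  [(26, 16861758478409072639), (28, 16933394959510208767), (48, 18434875764807947733),
    (29, 17560576956443112371), (29, 14956330734272352143), (6, 16897647093433237503)],
  [(44, 18412967080799240191), (47, 18413248549333565439), (33, 18446604433602085119),
    (56, 18293012375841134037), (50, 13527603490132833203), (37, 12650487725058658191)],
  [(1545, 12321708941082853631), (3188, 18434875764807947733), (1442, 12286101257000648703),
    (1547, 13525351690453365683), (1451, 12650487725058658191), (104, 11565384584870756351)],
  [(170, 12250072459981684735), (486, 18434884560900969941), (251, 12321717737175843071),
    (251, 13525360486412170163), (170, 10344644715844964239), (63, 12285969871098871807)],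
  [(46, 18374836017547968511), (78, 18446613229829325055), (46, 18374967952635133951),
    (92, 15984926363040994773), (92, 13525360486546387891), (42, 10344644715844964239)],
  [(1747, 18374686483966590975), (2948, 18446604433736302847), (2948, 18410996749662486527),
    (3918, 18290760576161666517), (3509, 13525351690453365683), (2621, 12650487725058658191)],
  [(36, 11065785813958758801), (13, 18415095248092893071), (19, 18446604433736302847),
    (16, 18374967952635133951), (11, 18374827221454946303)],
  [(48, 18374686483966590975), (81, 18446604433736302847), (71, 18374967952635133951),
    (73, 18290760576161666517), (68, 13525351690453365683), (52, 18415095248092893071)],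
  [(46, 18412967080799240191), (49, 18413248549333565439), (35, 18446604433602085119),
    (51, 15987169366627440085), (51, 13527603490132833203), (37, 18415095248092893071)],
  [(794, 12286101257009037311), (1796, 18434875764807947733), (794, 12321708941082853631),
    (890, 13525351690319147955), (890, 12650487725058658191), (69, 12141845886929993727)],
  [(413, 13525351690453365683), (493, 18434875764237522389), (292, 12650487725058658191),
    (493, 18446604433736302847), (413, 18374967952635133951), (292, 18374827221454946303)],
  [(44, 12321708941082853631), (93, 18434875764807947733), (41, 12286101257000648703),
    (45, 13525351690319147955), (45, 12650487725058658191), (6, 12285961075005849599)],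
  [(57, 18374827221454946303), (65, 18446604433602085119), (61, 18410996749528268799),
    (69, 18434875764103304661), (69, 18137037708746535859), (65, 14956330734272352143)],
  [(48, 18374686483966590975), (55, 18446604433602085119), (55, 18410996749528268799),
    (56, 18434875764103304661), (52, 18137037708746535859), (52, 17262173743486046095)],
  [(2078, 12286101257009037311), (4659, 18434875764807947733), (2078, 12321708941082853631),
    (2290, 13525351690319147955), (2290, 12650487725058658191), (177, 12285960525250035711)],
  [(27, 11065785813958758801), (9, 10344644715844964239), (8, 18446604433736302847),
    (8, 18410996749662486527), (5, 18410856568229724159)],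
  [(881, 18374686483966590975), (1459, 18446604433736302847), (1459, 18410996749662486527),
    (1817, 18434875764237522389), (1590, 13525351690453365683), (1095, 10344644715844964239)],
  [(166, 12177602548529596671), (405, 18290769372254690773), (355, 13525360486546389939),
    (166, 12650487725058658191), (31, 12141986068362756095), (31, 12141854683023015935)],
  [(38, 14088248660215432067), (19, 18434875764103304661), (14, 18446604433602085119),
    (14, 18410996749528268799), (14, 18410856568229724159)],
  [(13, 10344644715844964239), (15, 18434875764103304661), (15, 18425268084898247603),
    (15, 18446604433602085119), (14, 18410996749528268799), (13, 18374827221454946303)],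
  [(121, 12650487725058658191), (147, 18434875764103304661), (121, 13525351690319147955),
    (99, 18446604433602085119), (99, 18410996749528268799), (99, 18410856568229724159)],
  [(4, 9838263473623007231), (44, 15987178162854682069), (44, 13527612286360075187),
    (12, 10344644715844964239), (12, 9871759539315902719), (4, 9838394858962747391)],
  [(32, 12286101257009037311), (72, 18434875764807947733), (32, 12321708941082853631),
    (38, 13525351690453365683), (33, 10344644715844964239)],
  [(24, 17937837315816751103), (27, 18446620445484486543), (38, 15984926363040996821),
    (38, 13525360486546389939), (14, 9871759539315902719)],
  [(9, 17361517305296584703), (24, 18446620445484486543), (9, 17361658036342554623),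
    (33, 15984926363040996821), (33, 13525360486546389939), (12, 9871759539315902719)],
  [(15, 17361658036350943231), (36, 18446620445484486543), (13, 17361376567808229375),
    (48, 15984926363040996821), (48, 13525360486546389939), (16, 9871759539315902719)],
  [(32, 17361376567808229375), (85, 18446620445484486543), (37, 17938118788780195839),
    (126, 15984926363040996821), (126, 13525360486546389939), (47, 9871759539315902719)],
  [(73, 17361376563513327615), (79, 18446620445484486543), (91, 15984926363040996821),
    (91, 13525360486546389939), (35, 17942210071563831551)]]

/-- Checks that the certificates prove the families in a table to be FC-families. -/
noncomputable def checkAllFC : List (List ℕ) → List (List ℕ × ℕ) → Bool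
  | [], _ => true
  | _ :: _, [] => false
  | l :: ls, c :: cs => checkFC l (fun a => c.1.getD a 0) c.2 && checkAllFC ls cs

/-- Checks that the certificates prove the families in a table to be nonFC-families. -/
noncomputable def checkAllNonFC : List (List ℕ) → List (List (ℕ × ℕ)) → Bool
  | [], _ => true
  | _ :: _, [] => false
  | l :: ls, c :: cs => checkNonFC l c && checkAllNonFC ls cs

theorem isFC_of_checkAllFC {t : List (List ℕ)} {cs : List (List ℕ × ℕ)}
    (h : checkAllFC t cs = true) : ∀ l ∈ t, IsFC (familyOfCodes l) := by
  induction t generalizing cs with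
  | nil => simp
  | cons l t ih =>
    cases cs with
    | nil => simp [checkAllFC] at h
    | cons c cs =>
      rw [checkAllFC, Bool.and_eq_true] at h
      exact List.forall_mem_cons.2 ⟨isFC_of_checkFC h.1, ih h.2⟩

theorem isNonFC_of_checkAllNonFC {t : List (List ℕ)} {cs : List (List (ℕ × ℕ))}
    (h : checkAllNonFC t cs = true) : ∀ l ∈ t, IsNonFC (familyOfCodes l) := by
  induction t generalizing cs with
  | nil => simp
  | cons l t ih =>
    cases cs with
    | nil => simp [checkAllNonFC] at h
    | cons c cs =>
      rw [checkAllNonFC, Bool.and_eq_true] at h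
      exact List.forall_mem_cons.2 ⟨isNonFC_of_checkNonFC h.1, ih h.2⟩

/-! ### Evaluation of the certificates and the theorem. -/

theorem checkAllNonFC_ncSixTable : checkAllNonFC ncSixTable ncSixCertificates = true := by
  decide +kernel

/-- The searches are evaluated in blocks of 40 families, the last block having 37, to keep the
single computations moderate. -/
theorem checkAllFC_fcSixTable_drop_0 :
    checkAllFC ((fcSixTable.drop 0).take 40) ((fcSixCertificates.drop 0).take 40) = true := by
  decide +kernel

theorem checkAllFC_fcSixTable_drop_40 :
    checkAllFC ((fcSixTable.drop 40).take 40) ((fcSixCertificates.drop 40).take 40) = true := by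
  decide +kernel

theorem checkAllFC_fcSixTable_drop_80 :
    checkAllFC ((fcSixTable.drop 80).take 40) ((fcSixCertificates.drop 80).take 40) = true := by
  decide +kernel

theorem checkAllFC_fcSixTable_drop_120 :
    checkAllFC ((fcSixTable.drop 120).take 40) ((fcSixCertificates.drop 120).take 40) = true := by
  decide +kernel

theorem checkAllFC_fcSixTable_drop_160 :
    checkAllFC ((fcSixTable.drop 160).take 40) ((fcSixCertificates.drop 160).take 40) = true := by
  decide +kernel

theorem isFC_of_mem_fcSixTable : ∀ l ∈ fcSixTable, IsFC (familyOfCodes l) := by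
  intro l hl
  have e : fcSixTable = (fcSixTable.drop 0).take 40 ++ ((fcSixTable.drop 40).take 40 ++
      ((fcSixTable.drop 80).take 40 ++ ((fcSixTable.drop 120).take 40 ++
        (fcSixTable.drop 160).take 40))) := by
    decide +kernel
  rw [e] at hl
  simp only [List.mem_append] at hl
  rcases hl with hl | hl | hl | hl | hl
  exacts [isFC_of_checkAllFC checkAllFC_fcSixTable_drop_0 l hl,
    isFC_of_checkAllFC checkAllFC_fcSixTable_drop_40 l hl,
    isFC_of_checkAllFC checkAllFC_fcSixTable_drop_80 l hl,
    isFC_of_checkAllFC checkAllFC_fcSixTable_drop_120 l hl,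
    isFC_of_checkAllFC checkAllFC_fcSixTable_drop_160 l hl]

theorem card_FcSix : FcSix.card = 197 := by
  rw [FcSix, card_toFinset_map_familyOfCodes (by decide +kernel) (by decide +kernel)]
  decide +kernel

theorem card_NcSix : NcSix.card = 115 := by
  rw [NcSix, card_toFinset_map_familyOfCodes (by decide +kernel) (by decide +kernel)]
  decide +kernel

theorem mainTheorem2 :
    (FcSix.card = 197 ∧ ∀ F ∈ FcSix, IsFC F) ∧
    (NcSix.card = 115 ∧ ∀ N ∈ NcSix, IsNonFC N ∧ IsNonFC (unionClosure N)) := by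
  refine ⟨⟨card_FcSix, fun F hF => ?_⟩, card_NcSix, fun N hN => ?_⟩
  · obtain ⟨l, hl, rfl⟩ := List.mem_map.1 (List.mem_toFinset.1 hF)
    exact isFC_of_mem_fcSixTable l hl
  · obtain ⟨l, hl, rfl⟩ := List.mem_map.1 (List.mem_toFinset.1 hN)
    have h := isNonFC_of_checkAllNonFC checkAllNonFC_ncSixTable l hl
    exact ⟨h, h.unionClosure⟩
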